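/- Let $n\ge 1$ be an integer, let $\boldsymbol\varsigma=(\varsigma_1,\dots,\varsigma_n)\in\{+1,-1\}^n$ and let $\boldsymbol\lambda=(\lambda_1,\dots,\lambda_n)\in\mathbb{C}^n$ with $\sum_{l=1}^n\lambda_l=0$. Put $e(z)=e^{2\pi i z}$ and $$G(s;\boldsymbol\varsigma,\boldsymbol\lambda)=\prod_{l=1}^n\Gamma(s-\lambda_l)\,e\!\left(\tfrac{\varsigma_l(s-\lambda_l)}{4}\right),$$ and define the Bessel function $$J(x;\boldsymbol\varsigma,\boldsymbol\lambda)=\frac{1}{2\pi i}\int_{\mathcal C}G(s;\boldsymbol\varsigma,\boldsymbol\lambda)\,x^{-ns}\,ds,\qquad x>0,$$ where $\mathcal C$ is any contour $s=c(t)+it$ ($t$ increasing over $\mathbb{R}$), with $c:\mathbb{R}\to\mathbb{R}$ continuously differentiable and equal to a constant $\rho<\frac12-\frac1n$ for all large $|t|$, such that all the poles $\lambda_l-k$ ($1\le l\le n$, $k=0,1,2,\dots$) of $G$ lie to the left of $\mathcal C$. Then the integral converges absolutely for every $x>0$, $J(x;\boldsymbol\varsigma,\boldsymbol\lambda)$ is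 a smooth function of $x$ on $(0,\infty)$, and $w=J(x;\boldsymbol\varsigma,\boldsymbol\lambda)$ satisfies there the linear differential equation of order $n$ $$\sum_{j=1}^{n}V_{n,j}(\boldsymbol\lambda)\,x^{j}\,w^{(j)}+\left(V_{n,0}(\boldsymbol\lambda)-S_n(\boldsymbol\varsigma)\,(in)^n x^n\right)w=0,$$ where $$S_n(\boldsymbol\varsigma)=\prod_{l=1}^n\varsigma_l,\qquad V_{n,j}(\boldsymbol\lambda)=\sum_{m=0}^{n-j}A_{j,n-j-m}\,n^m\,\sigma_m(\boldsymbol\lambda)\quad(0\le j\le n),$$ and $\sigma_m(\boldsymbol\lambda)$ is the elementary symmetric polynomial of degree $m$ in $\lambda_1,\dots,\lambda_n$, with $\sigma_1(\boldsymbol\lambda)=0$. The $V_{n,j}$ are symmetric polynomials in $\boldsymbol\lambda$, and $V_{n,n}=1$. The integers $A_{j,m}$ are defined for $j,m\ge-1$, $(j,m)\ne(-1,-1)$, by the initial conditions $A_{-1,0}=1$, $A_{-1,m}=0$ for $m\ge1$, $A_{j,-1}=0$ for $j\ge0$, and the recurrence $A_{j,m}=jA_{j,m-1}+A_{j-1,m}$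 for $j,m\ge0$. Explicitly, $A_{0,0}=1$, $A_{0,m}=0$ for $m\ge1$, and $$A_{j,m}=\sum_{r=1}^{j}\frac{(-1)^{j-r}r^{m+j}}{r!\,(j-r)!}\qquad(j\ge1,\ m\ge0).$$ -/

import Mathlib

open scoped BigOperators ContDiff

noncomputable section

/-- The product `G(s; ς, lam) = ∏ l, Γ(s - lam l) e(ς l (s - lam l) / 4)`, where `e(z) = exp(2πiz)`
and the signs `ς l ∈ {+, -}` are the units of `ℤ`. -/
def gammaFactor {n : ℕ} (ς : Fin n → ℤˣ) (lam : Fin n → ℂ) (s : ℂ) : ℂ :=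
  ∏ l, Complex.Gamma (s - lam l) *
    Complex.exp (2 * Real.pi * Complex.I * ((((ς l : ℤˣ) : ℤ) : ℂ) * (s - lam l) / 4))

/-- The contour `t ↦ c t + i t`, `t` running upwards over `ℝ`, is admissible for the index `lam`:
it is continuously differentiable, it starts from `ρ - i∞`, ends at `ρ + i∞` and is vertical near
infinity, with `ρ < 1/2 - 1/n`, and all the poles `lam l - k` (`k = 0, 1, 2, …`) of `G` lie to the
left of it. -/
structure IsBarnesContour {n : ℕ} (lam : Fin n → ℂ) (c : ℝ → ℝ) : Prop where
  contDiff : ContDiff ℝ 1 c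
  vertical : ∃ ρ T : ℝ, ρ < 1 / 2 - 1 / (n : ℝ) ∧ ∀ t : ℝ, T ≤ |t| → c t = ρ
  left : ∀ (l : Fin n) (k : ℕ), (lam l - k).re < c (lam l - k).im

/-- The integrand of the Mellin–Barnes integral `∫ G(s; ς, lam) x ^ (-n s) ds`, written in the
parameter `t` of the contour `s = c t + i t`, with `ds = (c' t + i) dt`. -/
def besselIntegrand {n : ℕ} (ς : Fin n → ℤˣ) (lam : Fin n → ℂ) (c : ℝ → ℝ) (x t : ℝ) : ℂ :=
  gammaFactor ς lam ((c t : ℂ) + t * Complex.I) *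
    (x : ℂ) ^ (-(n : ℂ) * ((c t : ℂ) + t * Complex.I)) * (((deriv c t : ℝ) : ℂ) + Complex.I)

/-- The Bessel function `J(x; ς, lam) = (1 / 2πi) ∫ G(s; ς, lam) x ^ (-n s) ds`, the integral being
taken along the contour `s = c t + i t`. -/
def besselJ {n : ℕ} (ς : Fin n → ℤˣ) (lam : Fin n → ℂ) (c : ℝ → ℝ) (x : ℝ) : ℂ :=
  1 / (2 * Real.pi * Complex.I) * ∫ t : ℝ, besselIntegrand ς lam c x t

/-- The double sequence `A_{j,m}`, `j, m ≥ -1`, with both indices shifted by one: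
`shiftedA (j + 1) (m + 1) = A_{j,m}`. Initial conditions: `A_{-1,0} = 1`, `A_{-1,m} = 0` for `m ≥ 1`
and `A_{j,-1} = 0` for `j ≥ 0`; recurrence: `A_{j,m} = j A_{j,m-1} + A_{j-1,m}` for `j, m ≥ 0`.
The entry `A_{-1,-1}` is not used. -/
def shiftedA : ℕ → ℕ → ℤ
  | 0, 0 => 0
  | 0, 1 => 1
  | 0, _ + 2 => 0
  | _ + 1, 0 => 0
  | j + 1, m + 1 => (j : ℤ) * shiftedA (j + 1) m + shiftedA j (m + 1)

/-- The integers `A_{j,m}` for `j, m ≥ 0`. -/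
def besselA (j m : ℕ) : ℤ := shiftedA (j + 1) (m + 1)

/-- The polynomial `V_{n,j} = ∑_{m=0}^{n-j} A_{j,n-j-m} n^m σ_m` in `n` variables, where `σ_m` is the
elementary symmetric polynomial of degree `m`. -/
def besselV (n j : ℕ) : MvPolynomial (Fin n) ℤ :=
  ∑ m ∈ Finset.range (n + 1 - j),
    MvPolynomial.C (besselA j (n - j - m) * (n : ℤ) ^ m) * MvPolynomial.esymm (Fin n) ℤ m

end

/-!
Write `G(s)` for `gammaFactor ς lam s`. The integrand `G(s) x ^ (-n s)` satisfies the differential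
equation up to the translation `s ↦ s + 1`: the operator `∑ V_{n,j} x^j (d/dx)^j` multiplies
`x ^ (-n s)` by `∏ (-n s + n λ_l) = (-n)^n ∏ (s - λ_l)` (`sum_besselV_mul_descPochhammer`, where the
`A_{j,m}` enter as Stirling numbers of the second kind), and `∏ (s - λ_l) G(s)` is `G(s + 1)` up to
the constant `∏ (ς_l i)⁻¹` (`gammaFactor_add_one`). Since
`x ^ (-n s) = x ^ n · x ^ (-n (s + 1))`, what remains is to move the contour by `1`.

The analytic input is the bound `|Γ(σ + i t)| ≤ C |t| ^ (σ - 1/2) exp (-π |t| / 2)`, uniform for `σ`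
in a compact set (`exists_norm_Gamma_le`). It follows from the reflection formula on the line
`σ = 1/2`, the Phragmén–Lindelöf principle for `Γ(s) s ^ (1/2 - s)` on `1/2 ≤ σ ≤ 3/2`, and the
functional equation. As the `λ_l` have sum `0`, it gives `|G(s)| ≤ C |t| ^ (n (σ - 1/2))`, which is
integrable for `σ < 1/2 - 1/n`.

Differentiation under the integral sign costs a factor `|t|` each time, so the given contour does
not suffice. By Cauchy's theorem, proved here for a homotopy of contours that are graphs over the
imaginary axis (`intervalIntegral_contour_sub`, `integral_contour_eq`), the integral does not depend
on the contour. A contour with ends arbitrarily far to the left and still to the right of all poles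
is obtained from the given one with a bump function (`IsContourOfAbscissa.exists_of_abscissa`), and
on it the integral may be differentiated as often as desired.
-/

/-! ### Decay of the Gamma function on vertical lines -/

/-- Reflection formula on the line `re s = 1/2`, where `1 - s` is the conjugate of `s`:
`|Γ(1/2 + it)|² = π / cosh (π t)`. -/
lemma norm_Gamma_half_sq {s : ℂ} (hs : s.re = 1 / 2) :
    ‖Complex.Gamma s‖ ^ 2 = Real.pi / Real.cosh (Real.pi * s.im) := by
  have h1 : 1 - s = (starRingEnd ℂ) s := by
    apply Complex.ext
    · simp [hs]; norm_num
    · simp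
  have h2 := Complex.Gamma_mul_Gamma_one_sub s
  rw [h1, Complex.Gamma_conj, Complex.mul_conj, Complex.normSq_eq_norm_sq] at h2
  have h3 : (Real.pi : ℂ) * s =
      Real.pi / 2 - (-((Real.pi * s.im : ℝ) : ℂ)) * Complex.I := by
    apply Complex.ext
    · simp [hs]; ring
    · simp
  rw [h3, Complex.sin_pi_div_two_sub, Complex.cos_mul_I, Complex.cosh_neg] at h2
  exact_mod_cast h2

lemma norm_Gamma_half_le {s : ℂ} (hs : s.re = 1 / 2) :
    ‖Complex.Gamma s‖ ≤ Real.sqrt (2 * Real.pi) * Real.exp (-(Real.pi * |s.im| / 2)) := by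
  have h1 : Real.exp (Real.pi * |s.im|) / 2 ≤ Real.cosh (Real.pi * s.im) := by
    have h : Real.cosh (Real.pi * s.im) = Real.cosh (Real.pi * |s.im|) := by
      rw [← Real.cosh_abs, abs_mul, abs_of_pos Real.pi_pos]
    rw [h, Real.cosh_eq]
    linarith [Real.exp_pos (-(Real.pi * |s.im|))]
  refine (sq_le_sq₀ (norm_nonneg _) (by positivity)).1 ?_
  rw [norm_Gamma_half_sq hs, mul_pow, Real.sq_sqrt (by positivity), ← Real.exp_nat_mul]
  have h2 : ((2 : ℕ) : ℝ) * -(Real.pi * |s.im| / 2) = -(Real.pi * |s.im|) := by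
    push_cast; ring
  rw [h2, Real.exp_neg, ← div_eq_mul_inv]
  calc Real.pi / Real.cosh (Real.pi * s.im) ≤ Real.pi / (Real.exp (Real.pi * |s.im|) / 2) := by
        gcongr
    _ = 2 * Real.pi / Real.exp (Real.pi * |s.im|) := by field_simp

/-- On the right half-plane the modulus of `Γ` is at most its value at the real part. -/
lemma norm_Gamma_le_Gamma_re {s : ℂ} (hs : 0 < s.re) :
    ‖Complex.Gamma s‖ ≤ Real.Gamma s.re := by
  rw [Complex.Gamma_eq_integral hs, Real.Gamma_eq_integral hs, Complex.GammaIntegral]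
  refine (MeasureTheory.norm_integral_le_integral_norm _).trans_eq ?_
  refine MeasureTheory.setIntegral_congr_fun measurableSet_Ioi fun x hx => ?_
  have hx : 0 < x := hx
  simp only [norm_mul, Complex.norm_real, Real.norm_eq_abs, Real.abs_exp]
  rw [Complex.norm_cpow_eq_rpow_re_of_pos hx]
  simp

lemma im_mul_arg (s : ℂ) : s.im * s.arg = |s.im| * |s.arg| := by
  rw [← abs_mul, abs_of_nonneg]
  rcases le_or_gt 0 s.im with h | h
  · exact mul_nonneg h (Complex.arg_nonneg_iff.2 h)
  · exact mul_nonneg_of_nonpos_of_nonpos h.le (Complex.arg_neg_iff.2 h).le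

lemma im_mul_arg_le {s : ℂ} (hs : 0 ≤ s.re) : s.im * s.arg ≤ Real.pi * |s.im| / 2 := by
  rw [im_mul_arg]
  nlinarith [abs_nonneg s.im, Complex.abs_arg_le_pi_div_two_iff.2 hs]

/-- `arg s` is within `O(1 / |s|)` of `±π/2` on a vertical strip (Jordan's inequality applied to
`π/2 - |arg s|`). -/
lemma le_im_mul_arg {s : ℂ} (hs : 0 < s.re) :
    Real.pi * |s.im| / 2 - Real.pi * s.re / 2 ≤ s.im * s.arg := by
  have hs0 : s ≠ 0 := by rintro rfl; simp at hs
  have hn : 0 < ‖s‖ := norm_pos_iff.2 hs0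
  rw [im_mul_arg]
  have h1 := Complex.abs_arg_le_pi_div_two_iff.2 hs.le
  have h2 := Real.mul_le_sin (x := Real.pi / 2 - |s.arg|) (by linarith)
    (by linarith [abs_nonneg s.arg])
  rw [Real.sin_pi_div_two_sub, Real.cos_abs, Complex.cos_arg hs0, le_div_iff₀ hn] at h2
  have h3 : (Real.pi / 2 - |s.arg|) * ‖s‖ ≤ Real.pi * s.re / 2 := by
    have h4 := mul_le_mul_of_nonneg_left h2 Real.pi_pos.le
    have h5 : Real.pi * (2 / Real.pi * (Real.pi / 2 - |s.arg|) * ‖s‖) =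
        2 * ((Real.pi / 2 - |s.arg|) * ‖s‖) := by field_simp
    linarith
  have h6 := mul_le_mul_of_nonneg_left (Complex.abs_im_le_norm s)
    (sub_nonneg.2 h1)
  nlinarith

/-- The modulus of the reciprocal of the main factor `s ^ (s - 1/2)` in Stirling's formula. -/
lemma norm_cpow_half_sub {s : ℂ} (hs : s ≠ 0) :
    ‖s ^ (1 / 2 - s)‖ = ‖s‖ ^ (1 / 2 - s.re) * Real.exp (s.im * s.arg) := by
  rw [Complex.norm_cpow_of_ne_zero hs, div_eq_mul_inv, ← Real.exp_neg]
  have h1 : (1 / 2 - s).re = 1 / 2 - s.re := by simp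
  have h2 : (1 / 2 - s).im = -s.im := by simp
  rw [h1, h2]
  congr 2
  ring

/-- `Γ(s) s ^ (1/2 - s)` is bounded on the strip `1/2 ≤ re s ≤ 3/2`. It is bounded on the two edges
by the reflection formula, and it grows at most exponentially inside, so that the
Phragmén–Lindelöf principle applies. -/
lemma norm_Gamma_mul_cpow_le {s : ℂ} (h1 : 1 / 2 ≤ s.re) (h2 : s.re ≤ 3 / 2) :
    ‖Complex.Gamma s * s ^ (1 / 2 - s)‖ ≤ Real.sqrt (2 * Real.pi) := by
  have hedge : ∀ z : ℂ, z.re = 1 / 2 →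
      ‖Complex.Gamma z‖ * Real.exp (Real.pi * |z.im| / 2) ≤ Real.sqrt (2 * Real.pi) := by
    intro z hz
    calc _ ≤ Real.sqrt (2 * Real.pi) * Real.exp (-(Real.pi * |z.im| / 2)) *
          Real.exp (Real.pi * |z.im| / 2) := by gcongr; exact norm_Gamma_half_le hz
      _ = Real.sqrt (2 * Real.pi) := by rw [mul_assoc, ← Real.exp_add]; simp
  refine PhragmenLindelof.vertical_strip (f := fun s => Complex.Gamma s * s ^ (1 / 2 - s))
    (a := 1 / 2) (b := 3 / 2) ?_ ?_ ?_ ?_ h1 h2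
  · apply DifferentiableOn.diffContOnCl
    rw [Complex.closure_preimage_re, closure_Ioo (by norm_num)]
    intro z hz
    have hz0 : 0 < z.re := lt_of_lt_of_le (by norm_num) hz.1
    have hg : DifferentiableAt ℂ Complex.Gamma z := by
      refine Complex.differentiableAt_Gamma z fun m hm => ?_
      rw [hm] at hz0
      simp at hz0
      have : (0 : ℝ) ≤ m := by positivity
      linarith
    exact (hg.mul (differentiableAt_id.cpow ((differentiableAt_const _).sub differentiableAt_id)
      (Or.inl hz0))).differentiableWithinAt
  · obtain ⟨M, hM⟩ : ∃ M, ∀ σ ∈ Set.Icc (1 / 2 : ℝ) (3 / 2), Real.Gamma σ ≤ M := by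
      have hcont : ContinuousOn Real.Gamma (Set.Icc (1 / 2 : ℝ) (3 / 2)) :=
        Real.differentiableOn_Gamma_Ioi.continuousOn.mono fun x hx =>
          lt_of_lt_of_le (by norm_num) hx.1
      obtain ⟨M, hM⟩ := isCompact_Icc.bddAbove_image hcont
      exact ⟨M, fun σ hσ => hM ⟨σ, hσ, rfl⟩⟩
    refine ⟨1, ?_, Real.pi / 2, ?_⟩
    · rw [show (3 / 2 - 1 / 2 : ℝ) = 1 by norm_num, div_one]
      linarith [Real.pi_gt_three]
    · refine Asymptotics.IsBigO.of_bound (M * 2) ?_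
      refine Filter.mem_inf_of_right (Filter.mem_principal.2 fun z hz => ?_)
      have hz1 : 1 / 2 < z.re := hz.1
      have hz2 : z.re < 3 / 2 := hz.2
      have hz0 : z ≠ 0 := by rintro rfl; simp at hz1; linarith
      have hnz : 1 / 2 ≤ ‖z‖ := hz1.le.trans (Complex.re_le_norm z)
      have hG : ‖Complex.Gamma z‖ ≤ M :=
        (norm_Gamma_le_Gamma_re (by linarith)).trans (hM _ ⟨hz1.le, hz2.le⟩)
      have hM0 : 0 ≤ M := (norm_nonneg _).trans hG
      have hp : ‖z‖ ^ (1 / 2 - z.re) ≤ 2 := by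
        have e1 : ‖z‖ ^ (1 / 2 - z.re) ≤ (1 / 2 : ℝ) ^ (1 / 2 - z.re) :=
          Real.rpow_le_rpow_of_nonpos (by norm_num) hnz (by linarith)
        have e2 : (1 / 2 : ℝ) ^ (1 / 2 - z.re) ≤ (1 / 2 : ℝ) ^ (-1 : ℝ) :=
          Real.rpow_le_rpow_of_exponent_ge (by norm_num) (by norm_num) (by linarith)
        refine e1.trans (e2.trans_eq ?_)
        rw [Real.rpow_neg_one]; norm_num
      change ‖Complex.Gamma z * z ^ (1 / 2 - z)‖ ≤ _
      rw [norm_mul, norm_cpow_half_sub hz0, Real.norm_eq_abs, Real.abs_exp, mul_assoc M]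
      have he : z.im * z.arg ≤ Real.pi / 2 * Real.exp (1 * |z.im|) := by
        have e1 := im_mul_arg_le (s := z) (by linarith)
        have e2 := Real.add_one_le_exp (1 * |z.im|)
        nlinarith [Real.pi_pos]
      gcongr
  · intro z hz
    have hz0 : z ≠ 0 := by rintro rfl; norm_num at hz
    change ‖Complex.Gamma z * z ^ (1 / 2 - z)‖ ≤ _
    rw [norm_mul, norm_cpow_half_sub hz0, hz, sub_self, Real.rpow_zero, one_mul]
    refine le_trans ?_ (hedge z hz)
    gcongr
    exact im_mul_arg_le (by rw [hz]; norm_num)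
  · intro z hz
    have hz0 : z ≠ 0 := by rintro rfl; norm_num at hz
    have hw : (z - 1).re = 1 / 2 := by simp [hz]; norm_num
    have hw0 : z - 1 ≠ 0 := by intro h; rw [h] at hw; norm_num at hw
    have hG : Complex.Gamma z = (z - 1) * Complex.Gamma (z - 1) := by
      rw [← Complex.Gamma_add_one _ hw0, sub_add_cancel]
    have hle : ‖z - 1‖ ≤ ‖z‖ := by
      rw [← sq_le_sq₀ (norm_nonneg _) (norm_nonneg _), ← Complex.normSq_eq_norm_sq,
        ← Complex.normSq_eq_norm_sq, Complex.normSq_apply, Complex.normSq_apply]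
      rw [hw, hz, Complex.sub_im, Complex.one_im, sub_zero]
      linarith
    change ‖Complex.Gamma z * z ^ (1 / 2 - z)‖ ≤ _
    rw [norm_mul, norm_cpow_half_sub hz0, hz, hG, norm_mul,
      show (1 / 2 - 3 / 2 : ℝ) = -1 by norm_num, Real.rpow_neg_one]
    have hnz : 0 < ‖z‖ := norm_pos_iff.2 hz0
    calc ‖z - 1‖ * ‖Complex.Gamma (z - 1)‖ * (‖z‖⁻¹ * Real.exp (z.im * z.arg))
        = (‖z - 1‖ / ‖z‖) * (‖Complex.Gamma (z - 1)‖ * Real.exp (z.im * z.arg)) := by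
          field_simp
      _ ≤ 1 * (‖Complex.Gamma (z - 1)‖ * Real.exp (Real.pi * |(z - 1).im| / 2)) := by
          gcongr
          · exact div_le_one_of_le₀ hle hnz.le
          · have := im_mul_arg_le (s := z) (by rw [hz]; norm_num)
            simpa using this
      _ ≤ _ := by rw [one_mul]; exact hedge _ hw

lemma norm_Gamma_le_of_strip {s : ℂ} (h1 : 1 / 2 ≤ s.re) (h2 : s.re ≤ 3 / 2)
    (ht : 1 ≤ |s.im|) :
    ‖Complex.Gamma s‖ ≤ Real.sqrt (2 * Real.pi) * (5 / 2) * Real.exp (Real.pi * (3 / 2) / 2) *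
      (|s.im| ^ (s.re - 1 / 2) * Real.exp (-(Real.pi * |s.im| / 2))) := by
  have hs0 : s ≠ 0 := by rintro rfl; simp at h1; linarith
  have hn : 0 < ‖s‖ := norm_pos_iff.2 hs0
  have h := norm_Gamma_mul_cpow_le h1 h2
  rw [norm_mul, norm_cpow_half_sub hs0] at h
  have hp : ‖s‖ ^ (s.re - 1 / 2) ≤ 5 / 2 * |s.im| ^ (s.re - 1 / 2) := by
    have e1 : ‖s‖ ≤ 5 / 2 * |s.im| := by
      refine (Complex.norm_le_abs_re_add_abs_im s).trans ?_
      rw [abs_of_nonneg (by linarith)]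
      linarith
    calc ‖s‖ ^ (s.re - 1 / 2) ≤ (5 / 2 * |s.im|) ^ (s.re - 1 / 2) := by gcongr
      _ = (5 / 2 : ℝ) ^ (s.re - 1 / 2) * |s.im| ^ (s.re - 1 / 2) :=
        Real.mul_rpow (by norm_num) (by positivity)
      _ ≤ (5 / 2 : ℝ) ^ (1 : ℝ) * |s.im| ^ (s.re - 1 / 2) := by
        gcongr
        · norm_num
        · linarith
      _ = _ := by rw [Real.rpow_one]
  have he : Real.exp (-(s.im * s.arg)) ≤
      Real.exp (Real.pi * (3 / 2) / 2) * Real.exp (-(Real.pi * |s.im| / 2)) := by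
    rw [← Real.exp_add]
    have := le_im_mul_arg (s := s) (by linarith)
    gcongr
    nlinarith [Real.pi_pos]
  have hinv : ‖s‖ ^ (1 / 2 - s.re) * ‖s‖ ^ (s.re - 1 / 2) = 1 := by
    rw [← Real.rpow_add hn]; simp
  have hexp : Real.exp (s.im * s.arg) * Real.exp (-(s.im * s.arg)) = 1 := by
    rw [← Real.exp_add]; simp
  calc ‖Complex.Gamma s‖
      = (‖Complex.Gamma s‖ * (‖s‖ ^ (1 / 2 - s.re) * Real.exp (s.im * s.arg))) *
          (‖s‖ ^ (s.re - 1 / 2) * Real.exp (-(s.im * s.arg))) := by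
        rw [show ∀ g a b c d : ℝ, g * (a * b) * (c * d) = g * (a * c) * (b * d) by
          intros; ring, hinv, hexp]
        ring
    _ ≤ Real.sqrt (2 * Real.pi) * ((5 / 2 * |s.im| ^ (s.re - 1 / 2)) *
          (Real.exp (Real.pi * (3 / 2) / 2) * Real.exp (-(Real.pi * |s.im| / 2)))) := by
        gcongr
    _ = _ := by ring

/-- Vertical decay of the Gamma function, uniformly on every vertical strip. The functional equation
carries the bound from `1/2 ≤ re s ≤ 3/2` to the wider strips. -/
lemma exists_norm_Gamma_le (N : ℕ) : ∃ C : ℝ, 0 < C ∧ ∀ s : ℂ, |s.re - 1| ≤ N + 1 / 2 →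
    1 ≤ |s.im| →
    ‖Complex.Gamma s‖ ≤ C * (|s.im| ^ (s.re - 1 / 2) * Real.exp (-(Real.pi * |s.im| / 2))) := by
  induction N with
  | zero =>
    refine ⟨_, by positivity, fun s hs ht => norm_Gamma_le_of_strip ?_ ?_ ht⟩
    · have := (abs_le.1 hs).1; norm_num at this; linarith
    · have := (abs_le.1 hs).2; norm_num at this; linarith
  | succ N ih =>
    obtain ⟨C, hC, h⟩ := ih
    refine ⟨C * (N + 5 / 2), by positivity, fun s hs ht => ?_⟩
    push_cast at hs
    have ht0 : 0 < |s.im| := by linarith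
    have hpos : 0 ≤ |s.im| ^ (s.re - 1 / 2) * Real.exp (-(Real.pi * |s.im| / 2)) := by positivity
    obtain ⟨hs1, hs2⟩ := abs_le.1 hs
    rcases le_total s.re 1 with h1 | h1
    · by_cases hN : s.re - 1 ≥ -(N + 1 / 2)
      · refine (h s (abs_le.2 ⟨hN, ?_⟩) ht).trans ?_
        · have : (0 : ℝ) ≤ N := by positivity
          linarith
        · gcongr
          have : (0 : ℝ) ≤ N := by positivity
          nlinarith
      -- On the left, `Γ(s) = Γ(s + 1) / s`.
      have hs0 : s ≠ 0 := by rintro rfl; simp at ht0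
      have hn : 0 < ‖s‖ := norm_pos_iff.2 hs0
      have hb := h (s + 1) (by
        rw [Complex.add_re, Complex.one_re, abs_le]
        push Not at hN
        constructor
        · linarith
        · have : (0 : ℝ) ≤ N := by positivity
          linarith) (by simpa using ht)
      rw [Complex.Gamma_add_one s hs0, norm_mul] at hb
      simp only [Complex.add_re, Complex.one_re, Complex.add_im, Complex.one_im, add_zero] at hb
      rw [show s.re + 1 - 1 / 2 = (s.re - 1 / 2) + 1 by ring, Real.rpow_add_one ht0.ne'] at hb
      have hle := mul_le_mul_of_nonneg_right (Complex.abs_im_le_norm s)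
        (norm_nonneg (Complex.Gamma s))
      have h3 : ‖Complex.Gamma s‖ ≤
          C * (|s.im| ^ (s.re - 1 / 2) * Real.exp (-(Real.pi * |s.im| / 2))) := by
        refine le_of_mul_le_mul_left (hle.trans (hb.trans_eq ?_)) ht0
        ring
      refine h3.trans ?_
      gcongr
      have : (0 : ℝ) ≤ N := by positivity
      nlinarith
    · by_cases hN : s.re - 1 ≤ N + 1 / 2
      · refine (h s (abs_le.2 ⟨?_, hN⟩) ht).trans ?_
        · have : (0 : ℝ) ≤ N := by positivity
          linarith
        · gcongr
          have : (0 : ℝ) ≤ N := by positivity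
          nlinarith
      -- On the right, `Γ(s) = (s - 1) Γ(s - 1)`.
      have hs0 : s - 1 ≠ 0 := by
        intro h0
        have := congrArg Complex.im h0
        simp at this
        simp [this] at ht0
      have hb := h (s - 1) (by
        rw [Complex.sub_re, Complex.one_re, abs_le]
        push Not at hN
        constructor
        · have : (0 : ℝ) ≤ N := by positivity
          linarith
        · linarith) (by simpa using ht)
      have hG : Complex.Gamma s = (s - 1) * Complex.Gamma (s - 1) := by
        rw [← Complex.Gamma_add_one _ hs0, sub_add_cancel]
      rw [hG, norm_mul]
      simp only [Complex.sub_re, Complex.one_re, Complex.sub_im, Complex.one_im, sub_zero] at hb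
      have hn : ‖s - 1‖ ≤ (N + 5 / 2) * |s.im| := by
        refine (Complex.norm_le_abs_re_add_abs_im _).trans ?_
        simp only [Complex.sub_re, Complex.one_re, Complex.sub_im, Complex.one_im, sub_zero]
        have : (0 : ℝ) ≤ N := by positivity
        nlinarith
      calc ‖s - 1‖ * ‖Complex.Gamma (s - 1)‖
          ≤ ((N + 5 / 2) * |s.im|) * (C * (|s.im| ^ (s.re - 1 - 1 / 2) *
              Real.exp (-(Real.pi * |s.im| / 2)))) := by gcongr
        _ = _ := by
          rw [show s.re - 1 / 2 = (s.re - 1 - 1 / 2) + 1 by ring, Real.rpow_add_one ht0.ne']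
          ring

lemma rpow_le_two_rpow_mul_rpow {y t : ℝ} (ht : 0 < t) (h1 : t / 2 ≤ y) (h2 : y ≤ 2 * t) (e : ℝ) :
    y ^ e ≤ 2 ^ |e| * t ^ e := by
  have hy : 0 < y := by linarith
  have h : (y / t) ^ e ≤ 2 ^ |e| := by
    rcases le_total 0 e with he | he
    · rw [abs_of_nonneg he]
      exact Real.rpow_le_rpow (by positivity) (by rw [div_le_iff₀ ht]; exact h2) he
    · rw [abs_of_nonpos he, Real.rpow_neg (by norm_num), ← Real.inv_rpow (by norm_num)]
      refine Real.rpow_le_rpow_of_nonpos (by norm_num) ?_ he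
      rw [le_div_iff₀ ht]; linarith
  calc y ^ e = (y / t * t) ^ e := by rw [div_mul_cancel₀ _ ht.ne']
    _ = (y / t) ^ e * t ^ e := Real.mul_rpow (by positivity) ht.le
    _ ≤ _ := by gcongr

/-- The exponential factor `e(ε (s - μ) / 4)` never outgrows the decay of `Γ(s - μ)`, which leaves a
power of the imaginary part. -/
lemma exists_norm_Gamma_mul_exp_le (ε : ℤˣ) (μ : ℂ) (a b : ℝ) :
    ∃ C T : ℝ, 0 < C ∧ 0 ≤ T ∧ ∀ s : ℂ, a ≤ s.re → s.re ≤ b → T ≤ |s.im| →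
      ‖Complex.Gamma (s - μ) *
        Complex.exp (2 * Real.pi * Complex.I * (((ε : ℤ) : ℂ) * (s - μ) / 4))‖ ≤
        C * |s.im| ^ (s.re - μ.re - 1 / 2) := by
  obtain ⟨N, hN⟩ := exists_nat_gt (|a| + |b| + |μ.re| + 1)
  obtain ⟨C, hC, h⟩ := exists_norm_Gamma_le N
  refine ⟨C * 2 ^ (N : ℝ), 2 * |μ.im| + 2, by positivity, by positivity, fun s hsa hsb ht => ?_⟩
  have ht0 : 0 < |s.im| := by linarith [abs_nonneg μ.im]
  have hre : |s.re| ≤ |a| + |b| := abs_le.2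
    ⟨by linarith [neg_abs_le a, abs_nonneg b], by linarith [le_abs_self b, abs_nonneg a]⟩
  have h1 : |(s - μ).re - 1| ≤ N + 1 / 2 := by
    rw [Complex.sub_re]
    have := abs_le.1 hre
    have := neg_abs_le μ.re
    have := le_abs_self μ.re
    rw [abs_le]
    constructor <;> linarith
  have h2 : |(s - μ).re - 1 / 2| ≤ N := by
    rw [Complex.sub_re]
    have := abs_le.1 hre
    have := neg_abs_le μ.re
    have := le_abs_self μ.re
    rw [abs_le]
    constructor <;> linarith
  have him : |s.im| / 2 ≤ |(s - μ).im| := by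
    rw [Complex.sub_im]
    have := abs_sub_abs_le_abs_sub s.im μ.im
    linarith [abs_nonneg μ.im]
  have him2 : |(s - μ).im| ≤ 2 * |s.im| := by
    rw [Complex.sub_im]
    have := abs_sub s.im μ.im
    linarith [abs_nonneg μ.im]
  have hexp : ‖Complex.exp (2 * Real.pi * Complex.I * (((ε : ℤ) : ℂ) * (s - μ) / 4))‖ ≤
      Real.exp (Real.pi * |(s - μ).im| / 2) := by
    rw [Complex.norm_exp]
    apply Real.exp_le_exp.2
    have e1 : (2 * Real.pi * Complex.I * (((ε : ℤ) : ℂ) * (s - μ) / 4)).re =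
        -(Real.pi / 2 * (((ε : ℤ) : ℝ) * (s - μ).im)) := by
      have e2 : (2 * Real.pi * Complex.I * (((ε : ℤ) : ℂ) * (s - μ) / 4)) =
          ((Real.pi / 2 * ((ε : ℤ) : ℝ) : ℝ) : ℂ) * (Complex.I * (s - μ)) := by
        push_cast; ring
      rw [e2, Complex.re_ofReal_mul, Complex.I_mul_re]
      ring
    rw [e1]
    rcases Int.units_eq_one_or ε with rfl | rfl
    · have := neg_abs_le (s - μ).im
      simp only [Units.val_one, Int.cast_one]
      nlinarith [Real.pi_pos]
    · have := le_abs_self (s - μ).im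
      simp only [Units.val_neg, Units.val_one, Int.cast_neg, Int.cast_one]
      nlinarith [Real.pi_pos]
  rw [norm_mul]
  calc _ ≤ (C * (|(s - μ).im| ^ ((s - μ).re - 1 / 2) *
          Real.exp (-(Real.pi * |(s - μ).im| / 2)))) * Real.exp (Real.pi * |(s - μ).im| / 2) := by
        gcongr
        exact h _ h1 (by linarith [abs_nonneg μ.im])
    _ = C * |(s - μ).im| ^ ((s - μ).re - 1 / 2) := by
        rw [mul_assoc, mul_assoc, ← Real.exp_add]; simp
    _ ≤ C * (2 ^ |(s - μ).re - 1 / 2| * |s.im| ^ ((s - μ).re - 1 / 2)) := by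
        gcongr
        exact rpow_le_two_rpow_mul_rpow ht0 him him2 _
    _ ≤ C * (2 ^ (N : ℝ) * |s.im| ^ ((s - μ).re - 1 / 2)) := by
        gcongr
        norm_num
    _ = _ := by rw [Complex.sub_re, mul_assoc]

lemma exists_norm_gammaFactor_le {n : ℕ} (ς : Fin n → ℤˣ) {lam : Fin n → ℂ}
    (hlam : ∑ l, lam l = 0) (a b : ℝ) :
    ∃ C T : ℝ, 0 < C ∧ 1 ≤ T ∧ ∀ s : ℂ, a ≤ s.re → s.re ≤ b → T ≤ |s.im| →
      ‖gammaFactor ς lam s‖ ≤ C * |s.im| ^ (n * (s.re - 1 / 2)) := by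
  choose C T hC hT h using fun l => exists_norm_Gamma_mul_exp_le (ς l) (lam l) a b
  refine ⟨∏ l, C l, 1 + ∑ l, T l, Finset.prod_pos fun l _ => hC l, ?_, fun s ha hb ht => ?_⟩
  · linarith [Finset.sum_nonneg fun l (_ : l ∈ Finset.univ) => hT l]
  have hTl : ∀ l, T l ≤ |s.im| := fun l => by
    have := Finset.single_le_sum (fun l _ => hT l) (Finset.mem_univ l)
    linarith
  have ht0 : 0 < |s.im| := by
    linarith [Finset.sum_nonneg fun l (_ : l ∈ Finset.univ) => hT l]
  rw [gammaFactor, norm_prod]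
  calc _ ≤ ∏ l, C l * |s.im| ^ (s.re - (lam l).re - 1 / 2) :=
        Finset.prod_le_prod (fun _ _ => norm_nonneg _) fun l _ => h l s ha hb (hTl l)
    _ = _ := by
        rw [Finset.prod_mul_distrib, ← Real.rpow_sum_of_pos ht0]
        congr 2
        have hre : ∑ l, (lam l).re = 0 := by rw [← Complex.re_sum, hlam, Complex.zero_re]
        rw [Finset.sum_sub_distrib, Finset.sum_sub_distrib, hre]
        simp
        ring

/-! ### The numbers `A_{j,m}` and the polynomials `V_{n,j}` -/

lemma besselA_zero_right (j : ℕ) : besselA j 0 = 1 := by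
  induction j with
  | zero => simp [besselA, shiftedA]
  | succ j ih => rw [besselA, shiftedA, shiftedA, mul_zero, zero_add]; exact ih

lemma besselA_zero_left_succ (m : ℕ) : besselA 0 (m + 1) = 0 := by
  rw [besselA, shiftedA]
  simp [shiftedA]

lemma besselA_succ_succ (j m : ℕ) :
    besselA (j + 1) (m + 1) = (j + 1) * besselA (j + 1) m + besselA j (m + 1) := by
  simp only [besselA]
  rw [shiftedA]
  push_cast
  rfl

/-- The `A_{j,m}` are Stirling numbers of the second kind: they expand powers into falling
factorials. -/
lemma sum_besselA_mul_descPochhammer (k : ℕ) (z : ℂ) :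
    ∑ j ∈ Finset.range (k + 1), (besselA j (k - j) : ℂ) * (descPochhammer ℂ j).eval z = z ^ k := by
  induction k with
  | zero => simp [besselA_zero_right]
  | succ k ih =>
    have hstep : ∀ j ∈ Finset.range (k + 1),
        (besselA j (k - j) : ℂ) * (descPochhammer ℂ j).eval z * z =
        (j : ℂ) * besselA j (k - j) * (descPochhammer ℂ j).eval z +
          besselA j (k - j) * (descPochhammer ℂ (j + 1)).eval z := by
      intro j _
      rw [descPochhammer_succ_eval]
      ring
    rw [pow_succ, ← ih, Finset.sum_mul, Finset.sum_congr rfl hstep, Finset.sum_add_distrib]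
    rw [Finset.sum_range_succ' (fun j => (besselA j (k + 1 - j) : ℂ) * _),
      Finset.sum_range_succ' (fun j => (j : ℂ) * besselA j (k - j) * _),
      Finset.sum_range_succ (fun j => (besselA (j + 1) (k + 1 - (j + 1)) : ℂ) * _),
      Finset.sum_range_succ (fun j => (besselA j (k - j) : ℂ) * _)]
    have hk : ∀ j ∈ Finset.range k,
        (besselA (j + 1) (k + 1 - (j + 1)) : ℂ) * (descPochhammer ℂ (j + 1)).eval z =
        ((j + 1 : ℕ) : ℂ) * besselA (j + 1) (k - (j + 1)) * (descPochhammer ℂ (j + 1)).eval z +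
          besselA j (k - j) * (descPochhammer ℂ (j + 1)).eval z := by
      intro j hj
      obtain ⟨d, rfl⟩ := Nat.exists_eq_add_of_lt (Finset.mem_range.1 hj)
      rw [show j + d + 1 + 1 - (j + 1) = d + 1 by lia, show j + d + 1 - (j + 1) = d by lia,
        show j + d + 1 - j = d + 1 by lia, besselA_succ_succ]
      push_cast
      ring
    rw [Finset.sum_congr rfl hk, Finset.sum_add_distrib]
    simp [besselA_zero_right, besselA_zero_left_succ]
    ring

/-- The characteristic identity of the differential operator: applied to `x ^ z`, the operator
`∑ V_{n,j} x^j (d/dx)^j` has the eigenvalue `∏ (z + n λ_l)`. -/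
lemma sum_besselV_mul_descPochhammer {n : ℕ} (lam : Fin n → ℂ) (z : ℂ) :
    ∑ j ∈ Finset.range (n + 1),
      MvPolynomial.aeval lam (besselV n j) * (descPochhammer ℂ j).eval z =
    ∏ l, (z + n * lam l) := by
  have hprod : ∏ l, (z + n * lam l) = ∑ m ∈ Finset.range (n + 1),
      (n : ℂ) ^ m * MvPolynomial.aeval lam (MvPolynomial.esymm (Fin n) ℤ m) * z ^ (n - m) := by
    have h := congrArg (Polynomial.eval z) (Multiset.prod_X_add_C_eq_sum_esymm
      (Finset.univ.val.map fun l => (n : ℂ) * lam l))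
    rw [Multiset.map_map, Polynomial.eval_multiset_prod, Multiset.map_map,
      Polynomial.eval_finsetSum] at h
    simp only [Function.comp_def, Polynomial.eval_add, Polynomial.eval_X, Polynomial.eval_C,
      Polynomial.eval_mul, Polynomial.eval_pow, Multiset.card_map, Finset.card_val,
      Finset.card_univ, Fintype.card_fin] at h
    refine Eq.trans h (Finset.sum_congr rfl fun m _ => ?_)
    rw [MvPolynomial.aeval_esymm_eq_multiset_esymm, Finset.esymm_map_val, Finset.esymm_map_val,
      Finset.mul_sum]
    congr 1
    refine Finset.sum_congr rfl fun t ht => ?_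
    rw [Finset.prod_mul_distrib, Finset.prod_const, (Finset.mem_powersetCard.1 ht).2]
  rw [hprod]
  simp_rw [← sum_besselA_mul_descPochhammer _ z, besselV, map_sum, map_mul, Finset.sum_mul,
    Finset.mul_sum]
  rw [Finset.sum_sigma', Finset.sum_sigma']
  refine Finset.sum_bij' (fun p _ => ⟨p.2, p.1⟩) (fun p _ => ⟨p.2, p.1⟩) ?_ ?_ ?_ ?_ ?_
  · rintro ⟨j, m⟩ h
    simp only [Finset.mem_sigma, Finset.mem_range] at h ⊢
    lia
  · rintro ⟨m, j⟩ h
    simp only [Finset.mem_sigma, Finset.mem_range] at h ⊢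
    lia
  · intros; rfl
  · intros; rfl
  · rintro ⟨j, m⟩ h
    simp only [Finset.mem_sigma, Finset.mem_range] at h ⊢
    rw [show n - m - j = n - j - m by lia]
    simp only [map_pow, map_natCast, MvPolynomial.algHom_C]
    simp
    ring

lemma besselV_isSymmetric (n j : ℕ) : (besselV n j).IsSymmetric := by
  rw [besselV]
  refine (MvPolynomial.symmetricSubalgebra (Fin n) ℤ).sum_mem fun m _ => ?_
  exact (MvPolynomial.IsSymmetric.C _).mul (MvPolynomial.esymm_isSymmetric _ _ _)

lemma besselV_self (n : ℕ) : besselV n n = 1 := by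
  simp [besselV, besselA_zero_right]

/-- The `j`-th finite difference of `r ^ j` at `0` is `j!`. -/
lemma sum_neg_one_pow_mul_pow_div_factorial {j : ℕ} (hj : 1 ≤ j) :
    ∑ r ∈ Finset.Icc 1 j,
      (-1 : ℚ) ^ (j - r) * (r : ℚ) ^ j / ((r.factorial : ℚ) * ((j - r).factorial : ℚ)) = 1 := by
  have h := congrFun (fwdDiff_iter_eq_factorial (R := ℚ) (n := j)) 0
  rw [fwdDiff_iter_eq_sum_shift, Finset.sum_range_succ'] at h
  simp only [zero_add, nsmul_eq_mul, mul_one, zsmul_eq_mul, Nat.cast_zero,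
    zero_pow (show j ≠ 0 by lia), mul_zero, add_zero] at h
  have hf : (j.factorial : ℚ) ≠ 0 := by exact_mod_cast j.factorial_ne_zero
  rw [← mul_right_inj' hf, mul_one, Finset.mul_sum]
  change _ = (j.factorial : ℚ) at h
  rw [← Finset.Ico_add_one_right_eq_Icc, Finset.sum_Ico_eq_sum_range, Nat.add_sub_cancel]
  refine Eq.trans (Finset.sum_congr rfl fun r hr => ?_) h
  have hr := Finset.mem_range.1 hr
  rw [add_comm 1 r]
  push_cast [Nat.cast_choose ℚ (show r + 1 ≤ j by lia)]
  ring

lemma besselA_eq_sum (j m : ℕ) (hj : 1 ≤ j) :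
    (besselA j m : ℚ) = ∑ r ∈ Finset.Icc 1 j,
      (-1 : ℚ) ^ (j - r) * (r : ℚ) ^ (m + j) / ((r.factorial : ℚ) * ((j - r).factorial : ℚ)) := by
  induction m generalizing j with
  | zero => simp only [zero_add, besselA_zero_right, sum_neg_one_pow_mul_pow_div_factorial hj,
      Int.cast_one]
  | succ m ihm =>
    induction j, hj using Nat.le_induction with
    | base =>
      have h := ihm 1 le_rfl
      rw [besselA_succ_succ, besselA_zero_left_succ]
      simpa using h
    | succ j hj ihj =>
      rw [besselA_succ_succ]
      push_cast
      rw [ihm (j + 1) (by lia), ihj, Finset.sum_Icc_succ_top (by lia),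
        Finset.sum_Icc_succ_top (by lia), mul_add, add_right_comm, Finset.mul_sum,
        ← Finset.sum_add_distrib]
      congr 1
      · refine Finset.sum_congr rfl fun r hr => ?_
        obtain ⟨d, rfl⟩ := Nat.exists_eq_add_of_le (Finset.mem_Icc.1 hr).2
        rw [show r + d + 1 - r = d + 1 by lia, show r + d - r = d by lia, Nat.factorial_succ]
        push_cast
        have h1 : (r.factorial : ℚ) ≠ 0 := by exact_mod_cast r.factorial_ne_zero
        have h2 : (d.factorial : ℚ) ≠ 0 := by exact_mod_cast d.factorial_ne_zero
        field_simp
        ring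
      · push_cast
        ring

/-! ### Deformation of contours -/

/-- The contour `t ↦ c t + i t` moved horizontally by the proportion `u` towards `t ↦ d t + i t`. -/
def contourHomotopy (c d : ℝ → ℝ) (u t : ℝ) : ℂ :=
  ((c t + u * (d t - c t) : ℝ) : ℂ) + t * Complex.I

lemma contourHomotopy_zero (c d : ℝ → ℝ) (t : ℝ) :
    contourHomotopy c d 0 t = (c t : ℂ) + t * Complex.I := by simp [contourHomotopy]

lemma contourHomotopy_one (c d : ℝ → ℝ) (t : ℝ) :
    contourHomotopy c d 1 t = (d t : ℂ) + t * Complex.I := by simp [contourHomotopy]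

/-- Cauchy's theorem for the region between two contours and two horizontal segments. With
`z u t = contourHomotopy c d u t`, both `∂_u (F(z) ∂_t z)` and `∂_t (F(z) ∂_u z)` are equal to the
same function `D u t`, and the claim is the equality of its two iterated integrals. -/
lemma intervalIntegral_contour_sub {F : ℂ → ℂ} {U : Set ℂ} (hU : IsOpen U)
    (hF : DifferentiableOn ℂ F U) {c d : ℝ → ℝ} (hc : ContDiff ℝ 1 c) (hd : ContDiff ℝ 1 d)
    (hmem : ∀ t, ∀ u ∈ Set.Icc (0 : ℝ) 1, contourHomotopy c d u t ∈ U) (a b : ℝ) :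
    (∫ t in a..b, F ((d t : ℂ) + t * Complex.I) * ((deriv d t : ℝ) + Complex.I)) -
      (∫ t in a..b, F ((c t : ℂ) + t * Complex.I) * ((deriv c t : ℝ) + Complex.I)) =
    ((∫ u in (0 : ℝ)..1, F (contourHomotopy c d u b) * ((d b - c b : ℝ) : ℂ)) -
      ∫ u in (0 : ℝ)..1, F (contourHomotopy c d u a) * ((d a - c a : ℝ) : ℂ)) := by
  have hcc := hc.continuous
  have hdc := hd.continuous
  have hc' : Continuous (deriv c) := hc.continuous_deriv le_rfl
  have hd' : Continuous (deriv d) := hd.continuous_deriv le_rfl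
  have hcd : ∀ t, HasDerivAt c (deriv c t) t :=
    fun t => (hc.differentiable one_ne_zero t).hasDerivAt
  have hdd : ∀ t, HasDerivAt d (deriv d t) t :=
    fun t => (hd.differentiable one_ne_zero t).hasDerivAt
  have hFd : ∀ z ∈ U, HasDerivAt F (deriv F z) z :=
    fun z hz => (hF.differentiableAt (hU.mem_nhds hz)).hasDerivAt
  have hF' : ContinuousOn (deriv F) U := (hF.deriv hU).continuousOn
  let D : ℝ → ℝ → ℂ := fun u t =>
    deriv F (contourHomotopy c d u t) *
      (((deriv c t + u * (deriv d t - deriv c t) : ℝ) : ℂ) + Complex.I) * ((d t - c t : ℝ) : ℂ) +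
    F (contourHomotopy c d u t) * ((deriv d t - deriv c t : ℝ) : ℂ)
  have hz : Continuous fun p : ℝ × ℝ => contourHomotopy c d p.1 p.2 := by
    unfold contourHomotopy
    fun_prop
  have hmaps : Set.MapsTo (fun p : ℝ × ℝ => contourHomotopy c d p.1 p.2)
      (Set.Icc 0 1 ×ˢ Set.univ) U := fun p hp => hmem p.2 p.1 hp.1
  have hDc : ContinuousOn (Function.uncurry D) (Set.Icc 0 1 ×ˢ Set.univ) := by
    have h1 := hF'.comp hz.continuousOn hmaps
    have h2 := hF.continuousOn.comp hz.continuousOn hmaps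
    refine ((h1.mul ?_).mul ?_).add (h2.mul ?_)
    · exact Continuous.continuousOn (by fun_prop)
    · exact Continuous.continuousOn (by fun_prop)
    · exact Continuous.continuousOn (by fun_prop)
  have hDu : ∀ t, ContinuousOn (fun u => D u t) (Set.uIcc 0 1) := fun t => by
    rw [Set.uIcc_of_le zero_le_one]
    exact hDc.comp (f := fun u => (u, t)) (by fun_prop) fun u hu => ⟨hu, trivial⟩
  have hDt : ∀ u ∈ Set.Icc (0 : ℝ) 1, Continuous (fun t => D u t) := fun u hu => by
    rw [← continuousOn_univ]
    exact hDc.comp (f := fun t => (u, t)) (by fun_prop) fun t _ => ⟨hu, trivial⟩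
  have hu_deriv : ∀ t, ∀ u ∈ Set.uIcc (0 : ℝ) 1, HasDerivAt (fun u : ℝ =>
      F (contourHomotopy c d u t) *
        (((deriv c t + u * (deriv d t - deriv c t) : ℝ) : ℂ) + Complex.I)) (D u t) u := by
    intro t u hu
    rw [Set.uIcc_of_le zero_le_one] at hu
    have e1 : HasDerivAt (fun u : ℝ => contourHomotopy c d u t) ((d t - c t : ℝ) : ℂ) u := by
      unfold contourHomotopy
      refine (HasDerivAt.ofReal_comp ?_).add_const _
      simpa using ((hasDerivAt_id u).mul_const (d t - c t)).const_add (c t)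
    have e2 : HasDerivAt (fun u : ℝ =>
        ((deriv c t + u * (deriv d t - deriv c t) : ℝ) : ℂ) + Complex.I)
        ((deriv d t - deriv c t : ℝ) : ℂ) u := by
      refine (HasDerivAt.ofReal_comp ?_).add_const _
      simpa using ((hasDerivAt_id u).mul_const (deriv d t - deriv c t)).const_add (deriv c t)
    have e3 := (hFd _ (hmem t u hu)).scomp u e1
    refine (e3.mul e2).congr_deriv ?_
    simp only [D, smul_eq_mul, Function.comp_apply]
    ring
  have ht_deriv : ∀ u ∈ Set.Icc (0 : ℝ) 1, ∀ t, HasDerivAt (fun t : ℝ =>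
      F (contourHomotopy c d u t) * ((d t - c t : ℝ) : ℂ)) (D u t) t := by
    intro u hu t
    have e1 : HasDerivAt (fun t : ℝ => contourHomotopy c d u t)
        (((deriv c t + u * (deriv d t - deriv c t) : ℝ) : ℂ) + Complex.I) t := by
      unfold contourHomotopy
      refine HasDerivAt.add (HasDerivAt.ofReal_comp ?_) ?_
      · exact (hcd t).add (((hdd t).sub (hcd t)).const_mul u)
      · simpa using (hasDerivAt_id t).ofReal_comp.mul_const Complex.I
    have e2 : HasDerivAt (fun t : ℝ => ((d t - c t : ℝ) : ℂ))
        ((deriv d t - deriv c t : ℝ) : ℂ) t := ((hdd t).sub (hcd t)).ofReal_comp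
    have e3 := (hFd _ (hmem t u hu)).scomp t e1
    refine (e3.mul e2).congr_deriv ?_
    simp only [D, smul_eq_mul, Function.comp_apply]
    ring
  have hswap : ∫ u in (0 : ℝ)..1, ∫ t in a..b, D u t = ∫ t in a..b, ∫ u in (0 : ℝ)..1, D u t := by
    refine MeasureTheory.intervalIntegral_intervalIntegral_swap ?_
    refine MeasureTheory.IntegrableOn.mono_set (t := Set.uIcc 0 1 ×ˢ Set.uIcc a b) ?_
      (Set.prod_mono Set.uIoc_subset_uIcc Set.uIoc_subset_uIcc)
    refine ContinuousOn.integrableOn_compact (isCompact_uIcc.prod isCompact_uIcc) ?_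
    refine hDc.mono (Set.prod_mono ?_ (Set.subset_univ _))
    rw [Set.uIcc_of_le zero_le_one]
  have hK : ∀ e : ℝ → ℝ, ContDiff ℝ 1 e → (∀ t, (e t : ℂ) + t * Complex.I ∈ U) →
      IntervalIntegrable (fun t : ℝ => F ((e t : ℂ) + t * Complex.I) *
        ((deriv e t : ℝ) + Complex.I)) MeasureTheory.volume a b := by
    intro e he hm
    have h1 := he.continuous
    have h2 : Continuous (deriv e) := he.continuous_deriv le_rfl
    refine Continuous.intervalIntegrable ?_ _ _
    refine Continuous.mul ?_ (by fun_prop)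
    exact hF.continuousOn.comp_continuous (by fun_prop) hm
  have hE : ∀ t, IntervalIntegrable (fun u => F (contourHomotopy c d u t) *
      ((d t - c t : ℝ) : ℂ)) MeasureTheory.volume 0 1 := by
    intro t
    refine ContinuousOn.intervalIntegrable (ContinuousOn.mul ?_ continuousOn_const)
    rw [Set.uIcc_of_le zero_le_one]
    refine hF.continuousOn.comp (Continuous.continuousOn ?_) fun u hu => hmem t u hu
    unfold contourHomotopy
    fun_prop
  rw [← intervalIntegral.integral_sub, ← intervalIntegral.integral_sub (hE b) (hE a)]
  · have h1 : ∀ t, F ((d t : ℂ) + t * Complex.I) * ((deriv d t : ℝ) + Complex.I) -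
        F ((c t : ℂ) + t * Complex.I) * ((deriv c t : ℝ) + Complex.I) =
        ∫ u in (0 : ℝ)..1, D u t := by
      intro t
      rw [intervalIntegral.integral_eq_sub_of_hasDerivAt (hu_deriv t)
        (hDu t).intervalIntegrable, contourHomotopy_zero, contourHomotopy_one]
      simp
    simp_rw [h1]
    rw [← hswap]
    refine intervalIntegral.integral_congr fun u hu => ?_
    rw [Set.uIcc_of_le zero_le_one] at hu
    exact intervalIntegral.integral_eq_sub_of_hasDerivAt (fun t _ => ht_deriv u hu t)
      ((hDt u hu).intervalIntegrable _ _)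
  · exact hK d hd fun t => contourHomotopy_one c d t ▸ hmem t 1 (by simp)
  · exact hK c hc fun t => contourHomotopy_zero c d t ▸ hmem t 0 (by simp)

/-- The integrals of a holomorphic function along two contours agree if the function decays
uniformly on the horizontal segments between them. -/
lemma integral_contour_eq {F : ℂ → ℂ} {U : Set ℂ} (hU : IsOpen U)
    (hF : DifferentiableOn ℂ F U) {c d : ℝ → ℝ} (hc : ContDiff ℝ 1 c) (hd : ContDiff ℝ 1 d)
    (hmem : ∀ t, ∀ u ∈ Set.Icc (0 : ℝ) 1, contourHomotopy c d u t ∈ U)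
    (hci : MeasureTheory.Integrable fun t : ℝ =>
      F ((c t : ℂ) + t * Complex.I) * (((deriv c t : ℝ) : ℂ) + Complex.I))
    (hdi : MeasureTheory.Integrable fun t : ℝ =>
      F ((d t : ℂ) + t * Complex.I) * (((deriv d t : ℝ) : ℂ) + Complex.I))
    (hdecay : ∀ ε > 0, ∃ T : ℝ, ∀ t : ℝ, T ≤ |t| → ∀ u ∈ Set.Icc (0 : ℝ) 1,
      ‖F (contourHomotopy c d u t) * ((d t - c t : ℝ) : ℂ)‖ ≤ ε) :
    (∫ t : ℝ, F ((c t : ℂ) + t * Complex.I) * (((deriv c t : ℝ) : ℂ) + Complex.I)) =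
      ∫ t : ℝ, F ((d t : ℂ) + t * Complex.I) * (((deriv d t : ℝ) : ℂ) + Complex.I) := by
  have hlc := MeasureTheory.intervalIntegral_tendsto_integral hci
    (Filter.tendsto_neg_atTop_atBot (G := ℝ)) Filter.tendsto_id
  have hld := MeasureTheory.intervalIntegral_tendsto_integral hdi
    (Filter.tendsto_neg_atTop_atBot (G := ℝ)) Filter.tendsto_id
  have hsub := hld.sub hlc
  refine (sub_eq_zero.1 (tendsto_nhds_unique hsub ?_)).symm
  rw [Metric.tendsto_atTop]
  intro ε hε
  obtain ⟨T, hT⟩ := hdecay (ε / 4) (by positivity)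
  refine ⟨|T|, fun R hR => ?_⟩
  have hR0 : |R| = R := abs_of_nonneg ((abs_nonneg T).trans hR)
  have hbound : ∀ t : ℝ, |t| = R →
      ‖∫ u in (0 : ℝ)..1, F (contourHomotopy c d u t) * ((d t - c t : ℝ) : ℂ)‖ ≤ ε / 4 := by
    intro t ht
    refine (intervalIntegral.norm_integral_le_of_norm_le_const (C := ε / 4) fun u hu => ?_).trans ?_
    · rw [Set.uIoc_of_le zero_le_one] at hu
      exact hT t (by rw [ht]; exact (le_abs_self T).trans hR) u ⟨hu.1.le, hu.2⟩
    · simp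
  rw [dist_zero_right]
  simp only [id]
  rw [intervalIntegral_contour_sub hU hF hc hd hmem]
  refine (norm_sub_le _ _).trans_lt ?_
  have h1 := hbound R hR0
  have h2 := hbound (-R) (by rw [abs_neg, hR0])
  linarith

/-! ### The integrand on a contour -/

/-- The poles of `gammaFactor ς lam` are the zeros of `∏ 1 / Γ(s - lam l)`; this is the complement
of that closed set. -/
def gammaFactorDomain {n : ℕ} (lam : Fin n → ℂ) : Set ℂ :=
  {s | ∏ l, (Complex.Gamma (s - lam l))⁻¹ ≠ 0}

lemma mem_gammaFactorDomain {n : ℕ} {lam : Fin n → ℂ} {s : ℂ} :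
    s ∈ gammaFactorDomain lam ↔ ∀ (l : Fin n) (k : ℕ), s ≠ lam l - k := by
  rw [gammaFactorDomain, Set.mem_ofPred_eq, Finset.prod_ne_zero_iff]
  simp only [Finset.mem_univ, true_imp_iff, ne_eq, inv_eq_zero, Complex.Gamma_eq_zero_iff,
    not_exists]
  refine forall_congr' fun l => forall_congr' fun k => not_congr ?_
  rw [sub_eq_iff_eq_add, neg_add_eq_sub]

lemma isOpen_gammaFactorDomain {n : ℕ} (lam : Fin n → ℂ) : IsOpen (gammaFactorDomain lam) := by
  refine isOpen_ne_fun ?_ continuous_const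
  refine continuous_finsetProd _ fun l _ => ?_
  exact Complex.differentiable_one_div_Gamma.continuous.comp (continuous_id.sub continuous_const)

lemma differentiableOn_gammaFactor {n : ℕ} (ς : Fin n → ℤˣ) (lam : Fin n → ℂ) :
    DifferentiableOn ℂ (gammaFactor ς lam) (gammaFactorDomain lam) := by
  intro s hs
  rw [mem_gammaFactorDomain] at hs
  refine DifferentiableAt.differentiableWithinAt ?_
  unfold gammaFactor
  refine DifferentiableAt.fun_finsetProd fun l _ => DifferentiableAt.mul ?_ (by fun_prop)
  refine (Complex.differentiableAt_Gamma (s - lam l) fun m hm => hs l m ?_).comp s (by fun_prop)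
  linear_combination hm

lemma Complex.exp_two_pi_I_mul_unit_div_four (ε : ℤˣ) :
    Complex.exp (2 * Real.pi * Complex.I * (((ε : ℤ) : ℂ) / 4)) = ((ε : ℤ) : ℂ) * Complex.I := by
  rcases Int.units_eq_one_or ε with rfl | rfl
  · rw [show 2 * (Real.pi : ℂ) * Complex.I * ((((1 : ℤˣ) : ℤ) : ℂ) / 4) =
      Real.pi / 2 * Complex.I by simp; ring, Complex.exp_pi_div_two_mul_I]
    simp
  · rw [show 2 * (Real.pi : ℂ) * Complex.I * ((((-1 : ℤˣ) : ℤ) : ℂ) / 4) =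
      -Real.pi / 2 * Complex.I by simp; ring, Complex.exp_neg_pi_div_two_mul_I]
    simp

/-- The functional equation of `G`, from that of the Gamma function and `e(ς / 4) = ς i`. -/
lemma gammaFactor_add_one {n : ℕ} (ς : Fin n → ℤˣ) {lam : Fin n → ℂ} {s : ℂ}
    (hs : s ∈ gammaFactorDomain lam) :
    gammaFactor ς lam (s + 1) =
      (∏ l, (s - lam l)) * ((((∏ l, ς l : ℤˣ) : ℤ) : ℂ) * Complex.I ^ n) *
        gammaFactor ς lam s := by
  rw [mem_gammaFactorDomain] at hs
  have hI : (((∏ l, ς l : ℤˣ) : ℤ) : ℂ) * Complex.I ^ n =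
      ∏ l, (((ς l : ℤ) : ℂ) * Complex.I) := by
    rw [Finset.prod_mul_distrib, Finset.prod_const, Finset.card_univ, Fintype.card_fin,
      Units.coe_prod, Int.cast_prod]
  rw [hI, gammaFactor, gammaFactor, ← Finset.prod_mul_distrib, ← Finset.prod_mul_distrib]
  refine Finset.prod_congr rfl fun l _ => ?_
  have h0 : s - lam l ≠ 0 := by
    have := hs l 0
    simpa [sub_eq_zero] using this
  rw [show s + 1 - lam l = (s - lam l) + 1 by ring, Complex.Gamma_add_one _ h0,
    ← Complex.exp_two_pi_I_mul_unit_div_four,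
    show 2 * Real.pi * Complex.I * (((ς l : ℤ) : ℂ) * (s - lam l + 1) / 4) =
      2 * Real.pi * Complex.I * (((ς l : ℤ) : ℂ) / 4) +
      2 * Real.pi * Complex.I * (((ς l : ℤ) : ℂ) * (s - lam l) / 4) by ring, Complex.exp_add]
  ring

/-- A continuously differentiable contour `t ↦ c t + i t` that has all the poles of `G` on its left
and real part `ρ` near infinity, without a restriction on `ρ`. -/
structure IsContourOfAbscissa {n : ℕ} (lam : Fin n → ℂ) (ρ : ℝ) (c : ℝ → ℝ) : Prop where
  contDiff : ContDiff ℝ 1 c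
  vertical : ∃ T : ℝ, ∀ t : ℝ, T ≤ |t| → c t = ρ
  left : ∀ (l : Fin n) (k : ℕ), (lam l - k).re < c (lam l - k).im

namespace IsContourOfAbscissa

variable {n : ℕ} {lam : Fin n → ℂ} {ρ ρ' : ℝ} {c d : ℝ → ℝ}

lemma exists_abs_le (hc : IsContourOfAbscissa lam ρ c) : ∃ B, 0 ≤ B ∧ ∀ t, |c t| ≤ B := by
  obtain ⟨T, hT⟩ := hc.vertical
  obtain ⟨B, hB⟩ := (isCompact_Icc (a := -T) (b := T)).exists_bound_of_continuousOn
    hc.contDiff.continuous.continuousOn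
  refine ⟨|B| + |ρ|, by positivity, fun t => ?_⟩
  rcases le_total T |t| with h | h
  · rw [hT t h]; linarith [abs_nonneg B]
  · have := hB t (abs_le.1 h)
    rw [Real.norm_eq_abs] at this
    linarith [abs_nonneg ρ, le_abs_self B]

lemma exists_deriv_eq_zero (hc : IsContourOfAbscissa lam ρ c) :
    ∃ T : ℝ, ∀ t : ℝ, T ≤ |t| → c t = ρ ∧ deriv c t = 0 := by
  obtain ⟨T, hT⟩ := hc.vertical
  refine ⟨T + 1, fun t ht => ⟨hT t (by linarith), ?_⟩⟩
  have h : c =ᶠ[nhds t] fun _ => ρ := by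
    filter_upwards [continuous_abs.continuousAt.eventually (lt_mem_nhds (show T < |t| by linarith))]
      with u hu
    exact hT u hu.le
  rw [h.deriv_eq, deriv_const]

lemma contourHomotopy_mem (hc : IsContourOfAbscissa lam ρ c) (hd : IsContourOfAbscissa lam ρ' d)
    (t : ℝ) (u : ℝ) (hu : u ∈ Set.Icc (0 : ℝ) 1) :
    contourHomotopy c d u t ∈ gammaFactorDomain lam := by
  rw [mem_gammaFactorDomain]
  intro l k h
  have him : (lam l - k).im = t := by rw [← h]; simp [contourHomotopy]
  have hre : (lam l - k).re = c t + u * (d t - c t) := by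
    rw [← h]; simp [contourHomotopy]
  have h1 := hc.left l k
  have h2 := hd.left l k
  rw [him, hre] at h1 h2
  rcases le_total (c t) (d t) with hcd | hcd
  · linarith [mul_nonneg hu.1 (sub_nonneg.2 hcd)]
  · linarith [mul_nonneg (sub_nonneg.2 hu.2) (sub_nonneg.2 hcd)]

lemma mem_domain (hc : IsContourOfAbscissa lam ρ c) (t : ℝ) :
    (c t : ℂ) + t * Complex.I ∈ gammaFactorDomain lam := by
  have h := hc.contourHomotopy_mem hc t 0 (by simp)
  rwa [contourHomotopy_zero] at h

/-- Adding a bump function changes the abscissa at infinity and leaves the contour alone on a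
bounded set of heights that contains those of all the poles. -/
lemma exists_of_abscissa (hc : IsContourOfAbscissa lam ρ c) (ρ' : ℝ) :
    ∃ d, IsContourOfAbscissa lam ρ' d := by
  let B : ℝ := 1 + ∑ l, |(lam l).im|
  have hB : 0 < B := by positivity
  let χ : ContDiffBump (0 : ℝ) := ⟨B, B + 1, hB, by linarith⟩
  obtain ⟨T, hT⟩ := hc.vertical
  refine ⟨fun t => c t + (ρ' - ρ) * (1 - χ t), ?_, ⟨max T (B + 1), fun t ht => ?_⟩, fun l k => ?_⟩
  · have : ContDiff ℝ 1 χ := χ.contDiff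
    exact hc.contDiff.add (contDiff_const.mul (contDiff_const.sub this))
  · rw [hT t ((le_max_left _ _).trans ht), χ.zero_of_le_dist]
    · ring
    · rw [Real.dist_0_eq_abs]
      exact (le_max_right _ _).trans ht
  · have h1 : χ (lam l - k).im = 1 := by
      refine χ.one_of_mem_closedBall ?_
      rw [mem_closedBall_zero_iff, Real.norm_eq_abs]
      have := Finset.single_le_sum (fun l _ => abs_nonneg (lam l).im) (Finset.mem_univ l)
      change _ ≤ 1 + _
      simp only [Complex.sub_im, Complex.natCast_im, sub_zero]
      linarith
    simp only [h1, sub_self, mul_zero, add_zero]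
    exact hc.left l k

lemma add_one (hc : IsContourOfAbscissa lam ρ c) :
    IsContourOfAbscissa lam (ρ + 1) (fun t => c t + 1) where
  contDiff := hc.contDiff.add contDiff_const
  vertical := by
    obtain ⟨T, hT⟩ := hc.vertical
    exact ⟨T, fun t ht => by rw [hT t ht]⟩
  left l k := (hc.left l k).trans (lt_add_one _)

end IsContourOfAbscissa

lemma IsBarnesContour.exists_isContourOfAbscissa {n : ℕ} {lam : Fin n → ℂ} {c : ℝ → ℝ}
    (hc : IsBarnesContour lam c) :
    ∃ ρ, ρ < 1 / 2 - 1 / (n : ℝ) ∧ IsContourOfAbscissa lam ρ c := by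
  obtain ⟨ρ, T, hρ, hT⟩ := hc.vertical
  exact ⟨ρ, hρ, hc.contDiff, ⟨T, hT⟩, hc.left⟩

lemma integrable_of_norm_le_rpow {f : ℝ → ℂ} (hf : Continuous f) {C T e : ℝ} (he : e < -1)
    (h : ∀ t : ℝ, T ≤ |t| → ‖f t‖ ≤ C * |t| ^ e) : MeasureTheory.Integrable f := by
  have hint : MeasureTheory.Integrable fun t : ℝ => (1 + ‖t‖) ^ e := by
    have := integrable_one_add_norm (E := ℝ) (μ := MeasureTheory.volume) (r := -e)
      (by simp; linarith)
    simpa using this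
  refine hf.locallyIntegrable.integrable_of_isBigO_cocompact (g := fun t : ℝ => (1 + ‖t‖) ^ e)
    ?_ (hint.integrableAtFilter _)
  refine Asymptotics.IsBigO.of_bound (|C| * 2 ^ |e|) ?_
  filter_upwards [(tendsto_norm_cocompact_atTop (E := ℝ)).eventually_ge_atTop (max T 1)] with t ht
  rw [Real.norm_eq_abs] at ht
  have h1 : 1 ≤ |t| := (le_max_right _ _).trans ht
  have h2 := rpow_le_two_rpow_mul_rpow (y := |t|) (t := 1 + ‖t‖) (by positivity)
    (by rw [Real.norm_eq_abs]; linarith) (by rw [Real.norm_eq_abs]; linarith) e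
  calc ‖f t‖ ≤ C * |t| ^ e := h t ((le_max_left _ _).trans ht)
    _ ≤ |C| * (2 ^ |e| * (1 + ‖t‖) ^ e) := by gcongr; exact le_abs_self C
    _ = _ := by
      rw [Real.norm_of_nonneg (by positivity : (0 : ℝ) ≤ (1 + ‖t‖) ^ e)]
      ring

/-- The `j`-th derivative in `x` of `besselIntegrand`: that of `x ^ z` is `z (z - 1) ⋯ (z - j + 1)
x ^ (z - j)`, here with `z = -n s`. -/
noncomputable def besselDerivIntegrand {n : ℕ} (ς : Fin n → ℤˣ) (lam : Fin n → ℂ) (c : ℝ → ℝ) (j : ℕ)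
    (x t : ℝ) : ℂ :=
  gammaFactor ς lam ((c t : ℂ) + t * Complex.I) *
    ((descPochhammer ℂ j).eval (-(n : ℂ) * ((c t : ℂ) + t * Complex.I)) *
      (x : ℂ) ^ (-(n : ℂ) * ((c t : ℂ) + t * Complex.I) - j) *
        (((deriv c t : ℝ) : ℂ) + Complex.I))

lemma besselDerivIntegrand_zero {n : ℕ} (ς : Fin n → ℤˣ) (lam : Fin n → ℂ) (c : ℝ → ℝ) :
    besselDerivIntegrand ς lam c 0 = besselIntegrand ς lam c := by
  ext x t
  simp [besselDerivIntegrand, besselIntegrand, mul_assoc]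

lemma norm_descPochhammer_eval_le (n j : ℕ) {B : ℝ} (hB : 0 ≤ B) :
    ∃ K : ℝ, 0 ≤ K ∧ ∀ σ t : ℝ, |σ| ≤ B → 1 ≤ |t| →
      ‖(descPochhammer ℂ j).eval (-(n : ℂ) * ((σ : ℂ) + t * Complex.I))‖ ≤ K * |t| ^ j := by
  induction j with
  | zero => exact ⟨1, zero_le_one, fun σ t _ _ => by simp⟩
  | succ j ih =>
    obtain ⟨K, hK, h⟩ := ih
    refine ⟨K * (n * (B + 1) + j), by positivity, fun σ t hσ ht => ?_⟩
    have h1 : ‖-(n : ℂ) * ((σ : ℂ) + t * Complex.I) - j‖ ≤ (n * (B + 1) + j) * |t| := by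
      calc _ ≤ ‖-(n : ℂ) * ((σ : ℂ) + t * Complex.I)‖ + ‖(j : ℂ)‖ := norm_sub_le _ _
        _ ≤ n * (|σ| + |t|) + j := by
          rw [norm_mul, norm_neg, Complex.norm_natCast, Complex.norm_natCast]
          gcongr
          refine (norm_add_le _ _).trans ?_
          simp
        _ ≤ n * (B * |t| + |t|) + j * |t| := by
          gcongr
          · nlinarith
          · have : (0 : ℝ) ≤ j := by positivity
            nlinarith
        _ = _ := by ring
    rw [descPochhammer_succ_eval, norm_mul]
    calc _ ≤ (K * |t| ^ j) * ((n * (B + 1) + j) * |t|) := by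
          gcongr
          exact h σ t hσ ht
      _ = _ := by ring

section

variable {n : ℕ} (ς : Fin n → ℤˣ) {lam : Fin n → ℂ} {ρ ρ' : ℝ} {c d : ℝ → ℝ}

lemma continuous_besselDerivIntegrand (hc : IsContourOfAbscissa lam ρ c) (j : ℕ) {x : ℝ}
    (hx : 0 < x) : Continuous (besselDerivIntegrand ς lam c j x) := by
  have h1 := hc.contDiff.continuous
  have h2 : Continuous (deriv c) := hc.contDiff.continuous_deriv le_rfl
  have h3 : Continuous fun t : ℝ => (c t : ℂ) + t * Complex.I := by fun_prop
  unfold besselDerivIntegrand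
  refine Continuous.mul ?_ (Continuous.mul (Continuous.mul ?_ ?_) (by fun_prop))
  · exact (differentiableOn_gammaFactor ς lam).continuousOn.comp_continuous h3 hc.mem_domain
  · exact (descPochhammer ℂ j).continuous.comp (continuous_const.mul h3)
  · refine Continuous.const_cpow (by fun_prop) (Or.inl ?_)
    exact_mod_cast hx.ne'

lemma integrable_besselDerivIntegrand (hlam : ∑ l, lam l = 0) (hc : IsContourOfAbscissa lam ρ c)
    {j : ℕ} (hj : n * (ρ - 1 / 2) + j < -1) {x : ℝ} (hx : 0 < x) :
    MeasureTheory.Integrable (besselDerivIntegrand ς lam c j x) := by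
  obtain ⟨T₁, h₁⟩ := hc.exists_deriv_eq_zero
  obtain ⟨B, hB, h₂⟩ := hc.exists_abs_le
  obtain ⟨C, T₂, hC, hT₂, h₃⟩ := exists_norm_gammaFactor_le ς hlam (-B) B
  obtain ⟨K, hK, h₄⟩ := norm_descPochhammer_eval_le n j hB
  refine integrable_of_norm_le_rpow (continuous_besselDerivIntegrand ς hc j hx)
    (C := C * (K * x ^ (-n * ρ - j))) (T := max T₁ T₂) hj fun t ht => ?_
  obtain ⟨hct, hdt⟩ := h₁ t ((le_max_left _ _).trans ht)
  have hT : T₂ ≤ |t| := (le_max_right _ _).trans ht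
  have ht0 : 0 < |t| := by linarith
  have e1 := h₃ ((c t : ℂ) + t * Complex.I) (by simpa using (abs_le.1 (h₂ t)).1)
    (by simpa using (abs_le.1 (h₂ t)).2) (by simpa using hT)
  have e2 := h₄ (c t) t (h₂ t) (by linarith)
  have e3 : ‖(x : ℂ) ^ (-(n : ℂ) * ((c t : ℂ) + t * Complex.I) - j)‖ = x ^ (-n * ρ - j) := by
    rw [Complex.norm_cpow_eq_rpow_re_of_pos hx]
    simp [hct]
  simp only [Complex.add_re, Complex.ofReal_re, Complex.mul_re, Complex.I_re, mul_zero,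
    Complex.ofReal_im, Complex.I_im, mul_one, sub_self, add_zero, Complex.add_im, Complex.mul_im,
    zero_add, hct] at e1
  rw [besselDerivIntegrand, norm_mul, norm_mul, norm_mul, e3, hdt, Real.rpow_add ht0,
    Real.rpow_natCast]
  rw [hct] at e2 ⊢
  have hx0 : 0 ≤ x ^ (-n * ρ - j) := by positivity
  calc _ ≤ (C * |t| ^ (n * (ρ - 1 / 2))) * ((K * |t| ^ j) * x ^ (-n * ρ - j) * 1) := by
        gcongr
        simp
    _ = _ := by ring

lemma hasDerivAt_integral_besselDerivIntegrand (hlam : ∑ l, lam l = 0)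
    (hc : IsContourOfAbscissa lam ρ c) {j : ℕ} (hj : n * (ρ - 1 / 2) + (j + 1 : ℕ) < -1) {x : ℝ}
    (hx : 0 < x) :
    HasDerivAt (fun y => ∫ t, besselDerivIntegrand ς lam c j y t)
      (∫ t, besselDerivIntegrand ς lam c (j + 1) x t) x := by
  obtain ⟨B, hB, hcB⟩ := hc.exists_abs_le
  have hj' : n * (ρ - 1 / 2) + j < -1 := by push_cast at hj; linarith
  have hint := integrable_besselDerivIntegrand ς hlam hc hj hx
  have hball : ∀ y ∈ Metric.ball x (x / 2), 0 < y ∧ x / 2 ≤ y ∧ y ≤ 2 * x := by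
    intro y hy
    rw [Metric.mem_ball, Real.dist_eq, abs_lt] at hy
    refine ⟨?_, ?_, ?_⟩ <;> linarith
  refine (hasDerivAt_integral_of_dominated_loc_of_deriv_le
    (bound := fun t => 2 ^ (n * B + (j + 1 : ℕ)) * ‖besselDerivIntegrand ς lam c (j + 1) x t‖)
    (Metric.ball_mem_nhds x (half_pos hx)) ?_ ?_ ?_ ?_ ?_ ?_).2
  · filter_upwards [lt_mem_nhds hx] with y hy
    exact (continuous_besselDerivIntegrand ς hc j hy).aestronglyMeasurable
  · exact integrable_besselDerivIntegrand ς hlam hc hj' hx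
  · exact (continuous_besselDerivIntegrand ς hc _ hx).aestronglyMeasurable
  · refine Filter.Eventually.of_forall fun t y hy => ?_
    obtain ⟨hy0, hy1, hy2⟩ := hball y hy
    have hnorm : ∀ y : ℝ, 0 < y →
        ‖(y : ℂ) ^ (-(n : ℂ) * ((c t : ℂ) + t * Complex.I) - (j + 1 : ℕ))‖ =
          y ^ (-n * c t - (j + 1 : ℕ)) := by
      intro y hy
      rw [Complex.norm_cpow_eq_rpow_re_of_pos hy]
      simp
    have he : |-n * c t - (j + 1 : ℕ)| ≤ n * B + (j + 1 : ℕ) := by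
      refine (abs_sub _ _).trans ?_
      rw [abs_mul, abs_neg, Nat.abs_cast, Nat.abs_cast]
      gcongr
      exact hcB t
    have hpow : y ^ (-n * c t - (j + 1 : ℕ)) ≤
        2 ^ (n * B + (j + 1 : ℕ)) * x ^ (-n * c t - (j + 1 : ℕ)) := by
      refine (rpow_le_two_rpow_mul_rpow hx hy1 hy2 _).trans ?_
      gcongr
      norm_num
    simp only [besselDerivIntegrand, norm_mul, hnorm y hy0, hnorm x hx]
    calc _ ≤ _ := by
          refine mul_le_mul_of_nonneg_left (mul_le_mul_of_nonneg_right
            (mul_le_mul_of_nonneg_left hpow ?_) ?_) ?_ <;> positivity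
      _ = _ := by ring
  · exact hint.norm.const_mul _
  · refine Filter.Eventually.of_forall fun t y hy => ?_
    obtain ⟨hy0, -, -⟩ := hball y hy
    unfold besselDerivIntegrand
    have h1 := ((hasDerivAt_id (y : ℂ)).cpow_const
      (c := -(n : ℂ) * ((c t : ℂ) + t * Complex.I) - j)
      (Or.inl (by simpa using hy0))).comp_ofReal
    refine (((h1.const_mul _).mul_const _).const_mul _).congr_deriv ?_
    rw [descPochhammer_succ_eval]
    simp only [id]
    rw [show -(n : ℂ) * ((c t : ℂ) + t * Complex.I) - ((j + 1 : ℕ) : ℂ) =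
      -(n : ℂ) * ((c t : ℂ) + t * Complex.I) - j - 1 by push_cast; ring]
    ring

/-- The Mellin–Barnes integral does not depend on the contour. -/
lemma integral_besselIntegrand_eq (hlam : ∑ l, lam l = 0)
    (hc : IsContourOfAbscissa lam ρ c) (hd : IsContourOfAbscissa lam ρ' d)
    (hρ : n * (ρ - 1 / 2) < -1) (hρ' : n * (ρ' - 1 / 2) < -1) {x : ℝ} (hx : 0 < x) :
    ∫ t, besselIntegrand ς lam c x t = ∫ t, besselIntegrand ς lam d x t := by
  have hci := integrable_besselDerivIntegrand ς hlam hc (j := 0) (by simpa using hρ) hx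
  have hdi := integrable_besselDerivIntegrand ς hlam hd (j := 0) (by simpa using hρ') hx
  rw [besselDerivIntegrand_zero] at hci hdi
  have hx0 : (x : ℂ) ≠ 0 := by exact_mod_cast hx.ne'
  refine integral_contour_eq (F := fun s => gammaFactor ς lam s * (x : ℂ) ^ (-(n : ℂ) * s))
    (isOpen_gammaFactorDomain lam) ?_ hc.contDiff hd.contDiff (hc.contourHomotopy_mem hd) hci hdi ?_
  · refine (differentiableOn_gammaFactor ς lam).mul fun s _ => ?_
    exact ((differentiableAt_id.const_mul _).const_cpow (Or.inl hx0)).differentiableWithinAt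
  intro ε hε
  obtain ⟨T₁, h₁⟩ := hc.vertical
  obtain ⟨T₂, h₂⟩ := hd.vertical
  set B := |ρ| + |ρ'| with hBdef
  obtain ⟨C, T₃, hC, hT₃, h₃⟩ := exists_norm_gammaFactor_le ς hlam (-B) B
  set M := C * Real.exp (|Real.log x| * (n * B)) * |ρ' - ρ| with hM
  have hM0 : 0 ≤ M := by positivity
  refine ⟨max (max T₁ T₂) (max T₃ (M / ε)), fun t ht u hu => ?_⟩
  have ht1 : T₁ ≤ |t| := (le_max_left _ _).trans ((le_max_left _ _).trans ht)
  have ht2 : T₂ ≤ |t| := (le_max_right _ _).trans ((le_max_left _ _).trans ht)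
  have ht3 : T₃ ≤ |t| := (le_max_left _ _).trans ((le_max_right _ _).trans ht)
  have ht4 : M / ε ≤ |t| := (le_max_right _ _).trans ((le_max_right _ _).trans ht)
  have ht0 : 1 ≤ |t| := hT₃.trans ht3
  set z := contourHomotopy c d u t with hz
  have hzre : z.re = (1 - u) * ρ + u * ρ' := by
    simp [hz, contourHomotopy, h₁ t ht1, h₂ t ht2]; ring
  have hzim : z.im = t := by simp [hz, contourHomotopy]
  have hu0 : 0 ≤ 1 - u := sub_nonneg.2 hu.2
  have hzB : |z.re| ≤ B := by
    rw [hzre, hBdef]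
    refine (abs_add_le _ _).trans ?_
    rw [abs_mul, abs_mul, abs_of_nonneg hu0, abs_of_nonneg hu.1]
    gcongr
    · exact mul_le_of_le_one_left (abs_nonneg _) (by linarith [hu.1])
    · exact mul_le_of_le_one_left (abs_nonneg _) hu.2
  have hexp : (n : ℝ) * (z.re - 1 / 2) ≤ -1 := by
    have : (n : ℝ) * (z.re - 1 / 2) =
        (1 - u) * (n * (ρ - 1 / 2)) + u * (n * (ρ' - 1 / 2)) := by rw [hzre]; ring
    rw [this]
    nlinarith [hu.1, hu0]
  have e1 : ‖gammaFactor ς lam z‖ ≤ C * |t|⁻¹ := by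
    refine (h₃ z (abs_le.1 hzB).1 (abs_le.1 hzB).2 (by rwa [hzim])).trans ?_
    rw [hzim, ← Real.rpow_neg_one]
    gcongr
  have e2 : ‖(x : ℂ) ^ (-(n : ℂ) * z)‖ ≤ Real.exp (|Real.log x| * (n * B)) := by
    rw [Complex.norm_cpow_eq_rpow_re_of_pos hx, Real.rpow_def_of_pos hx]
    refine Real.exp_le_exp.2 ?_
    refine (le_abs_self _).trans ?_
    rw [abs_mul]
    gcongr
    simp [abs_mul]
    gcongr
  rw [norm_mul, norm_mul, h₁ t ht1, h₂ t ht2, Complex.norm_real, Real.norm_eq_abs]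
  calc _ ≤ (C * |t|⁻¹) * Real.exp (|Real.log x| * (n * B)) * |ρ' - ρ| := by gcongr
    _ = M / |t| := by rw [hM]; ring
    _ ≤ ε := by
      rw [div_le_iff₀ (by linarith)]
      rw [div_le_iff₀ hε] at ht4
      linarith

/-- Integrated form of the functional equation: summing the derivatives of the integrand against
the `V_{n,j}` turns `G(s)` into `G(s + 1)`, which is the integrand of the contour moved by `1`. -/
lemma sum_besselV_mul_besselDerivIntegrand (hc : IsContourOfAbscissa lam ρ c) {x : ℝ} (hx : 0 < x)
    (t : ℝ) :
    ∑ j ∈ Finset.range (n + 1), MvPolynomial.aeval lam (besselV n j) * (x : ℂ) ^ j *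
        besselDerivIntegrand ς lam c j x t =
      (((∏ l, ς l : ℤˣ) : ℤ) : ℂ) * (Complex.I * n) ^ n * (x : ℂ) ^ n *
        besselIntegrand ς lam (fun t => c t + 1) x t := by
  have hx0 : (x : ℂ) ≠ 0 := by exact_mod_cast hx.ne'
  set s : ℂ := (c t : ℂ) + t * Complex.I with hs
  have hs1 : ((c t + 1 : ℝ) : ℂ) + t * Complex.I = s + 1 := by rw [hs]; push_cast; ring
  have hterm : ∀ j ∈ Finset.range (n + 1),
      MvPolynomial.aeval lam (besselV n j) * (x : ℂ) ^ j * besselDerivIntegrand ς lam c j x t =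
      MvPolynomial.aeval lam (besselV n j) * (descPochhammer ℂ j).eval (-(n : ℂ) * s) *
        (gammaFactor ς lam s * (x : ℂ) ^ (-(n : ℂ) * s) * ((deriv c t : ℝ) + Complex.I)) := by
    intro j _
    rw [besselDerivIntegrand, ← hs, Complex.cpow_sub _ _ hx0, Complex.cpow_natCast]
    have : (x : ℂ) ^ j ≠ 0 := pow_ne_zero _ hx0
    field_simp
  have hprod : ∏ l, (-(n : ℂ) * s + n * lam l) = (-(n : ℂ)) ^ n * ∏ l, (s - lam l) := by
    have h : ∀ l ∈ Finset.univ, -(n : ℂ) * s + n * lam l = -(n : ℂ) * (s - lam l) :=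
      fun l _ => by ring
    rw [Finset.prod_congr rfl h, Finset.prod_mul_distrib, Finset.prod_const, Finset.card_univ,
      Fintype.card_fin]
  have hpow : (x : ℂ) ^ n * (x : ℂ) ^ (-(n : ℂ) * (s + 1)) = (x : ℂ) ^ (-(n : ℂ) * s) := by
    rw [← Complex.cpow_natCast, ← Complex.cpow_add _ _ hx0]
    congr 1
    ring
  have hsign : (((∏ l, ς l : ℤˣ) : ℤ) : ℂ) * (((∏ l, ς l : ℤˣ) : ℤ) : ℂ) = 1 := by
    rcases Int.units_eq_one_or (∏ l, ς l) with h | h <;> rw [h] <;> simp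
  have hII : (Complex.I * n) ^ n * Complex.I ^ n = (-(n : ℂ)) ^ n := by
    rw [← mul_pow]
    congr 1
    linear_combination (n : ℂ) * Complex.I_mul_I
  rw [Finset.sum_congr rfl hterm, ← Finset.sum_mul, sum_besselV_mul_descPochhammer, hprod,
    besselIntegrand, hs1, gammaFactor_add_one ς (hs ▸ hc.mem_domain t), deriv_add_const, ← hpow,
    ← hII]
  linear_combination (-((Complex.I * n) ^ n * Complex.I ^ n * (∏ l, (s - lam l)) *
    gammaFactor ς lam s * (x : ℂ) ^ n * (x : ℂ) ^ (-(n : ℂ) * (s + 1)) *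
    ((deriv c t : ℝ) + Complex.I))) * hsign

end

/-! ### Families of successive derivatives -/

lemma iteratedDeriv_eq_of_hasDerivAt {f : ℕ → ℝ → ℂ} {s : Set ℝ} (hs : IsOpen s) {N : ℕ}
    (h : ∀ j < N, ∀ x ∈ s, HasDerivAt (f j) (f (j + 1) x) x) {j : ℕ} (hj : j ≤ N) :
    ∀ x ∈ s, iteratedDeriv j (f 0) x = f j x := by
  induction j with
  | zero => intro x _; rw [iteratedDeriv_zero]
  | succ j ih =>
    intro x hx
    have he : iteratedDeriv j (f 0) =ᶠ[nhds x] f j := by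
      filter_upwards [hs.mem_nhds hx] with y hy using ih (by lia) y hy
    rw [iteratedDeriv_succ, he.deriv_eq, (h j (by lia) x hx).deriv]

lemma contDiffOn_of_hasDerivAt {f : ℕ → ℝ → ℂ} {s : Set ℝ} (hs : IsOpen s) {N : ℕ}
    (h : ∀ j ≤ N, ∀ x ∈ s, HasDerivAt (f j) (f (j + 1) x) x) :
    ContDiffOn ℝ N (f 0) s := by
  induction N generalizing f with
  | zero =>
    rw [Nat.cast_zero, contDiffOn_zero]
    exact fun x hx => (h 0 le_rfl x hx).continuousAt.continuousWithinAt
  | succ N ih =>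
    rw [Nat.cast_succ, contDiffOn_succ_iff_deriv_of_isOpen hs]
    refine ⟨fun x hx => (h 0 (by lia) x hx).differentiableAt.differentiableWithinAt,
      fun hN => absurd hN (by simp), ?_⟩
    refine (ih (f := fun j => f (j + 1)) fun j hj => h (j + 1) (by lia)).congr fun x hx => ?_
    exact (h 0 (by lia) x hx).deriv

/-! ### The differential equation -/

/-- A contour with a small enough abscissa represents `J` as an integral that may be differentiated
`N` times under the integral sign. -/
lemma exists_contour_hasDerivAt {n : ℕ} (hn : 1 ≤ n) (ς : Fin n → ℤˣ) {lam : Fin n → ℂ}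
    (hlam : ∑ l, lam l = 0) {c : ℝ → ℝ} {ρ : ℝ} (hρ : n * (ρ - 1 / 2) < -1)
    (hc : IsContourOfAbscissa lam ρ c) (N : ℕ) :
    ∃ (ρ' : ℝ) (d : ℝ → ℝ), n * (ρ' - 1 / 2) + N < -1 ∧ IsContourOfAbscissa lam ρ' d ∧
      (∀ x : ℝ, 0 < x → ∫ t, besselDerivIntegrand ς lam d 0 x t =
        ∫ t, besselIntegrand ς lam c x t) ∧
      ∀ j < N, ∀ x : ℝ, 0 < x → HasDerivAt (fun y => ∫ t, besselDerivIntegrand ς lam d j y t)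
        (∫ t, besselDerivIntegrand ς lam d (j + 1) x t) x := by
  have hn0 : (1 : ℝ) ≤ n := by exact_mod_cast hn
  have hρ' : n * ((1 / 2 - (N + 2 : ℝ)) - 1 / 2) + N < -1 := by
    have : (0 : ℝ) ≤ N := by positivity
    nlinarith
  obtain ⟨d, hd⟩ := hc.exists_of_abscissa (1 / 2 - (N + 2 : ℝ))
  refine ⟨_, d, hρ', hd, fun x hx => ?_, fun j hj x hx => ?_⟩
  · rw [besselDerivIntegrand_zero]
    refine integral_besselIntegrand_eq ς hlam hd hc ?_ hρ hx
    have : (0 : ℝ) ≤ N := by positivity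
    linarith
  · refine hasDerivAt_integral_besselDerivIntegrand ς hlam hd ?_ hx
    have : ((j + 1 : ℕ) : ℝ) ≤ N := by exact_mod_cast hj
    linarith

lemma contDiffOn_besselJ {n : ℕ} (hn : 1 ≤ n) (ς : Fin n → ℤˣ) {lam : Fin n → ℂ}
    (hlam : ∑ l, lam l = 0) {c : ℝ → ℝ} {ρ : ℝ} (hρ : n * (ρ - 1 / 2) < -1)
    (hc : IsContourOfAbscissa lam ρ c) : ContDiffOn ℝ ∞ (besselJ ς lam c) (Set.Ioi 0) := by
  refine contDiffOn_infty.2 fun N => ?_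
  obtain ⟨ρ', d, -, -, h0, hd⟩ := exists_contour_hasDerivAt hn ς hlam hρ hc (N + 1)
  have h := contDiffOn_of_hasDerivAt
    (f := fun j y => ∫ t, besselDerivIntegrand ς lam d j y t) isOpen_Ioi (N := N)
    fun j hj x hx => hd j (by lia) x hx
  refine (contDiffOn_const.mul (h.congr fun x hx => ?_) : ContDiffOn ℝ N (fun x =>
    1 / (2 * Real.pi * Complex.I) * ∫ t, besselIntegrand ς lam c x t) (Set.Ioi 0))
  exact (h0 x hx).symm

/-- The differential equation. On a contour `d` far enough to the left, the left-hand side is an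
integral over `d` of derivatives of the integrand, which the functional equation of `G` turns into
an integral over `d + 1`; this contour still represents `J`. -/
lemma besselJ_differential_equation {n : ℕ} (hn : 1 ≤ n) (ς : Fin n → ℤˣ) {lam : Fin n → ℂ}
    (hlam : ∑ l, lam l = 0) {c : ℝ → ℝ} {ρ : ℝ} (hρ : n * (ρ - 1 / 2) < -1)
    (hc : IsContourOfAbscissa lam ρ c) {x : ℝ} (hx : 0 < x) :
    ∑ j ∈ Finset.range (n + 1), MvPolynomial.aeval lam (besselV n j) * (x : ℂ) ^ j *
        iteratedDeriv j (besselJ ς lam c) x =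
      (((∏ l, ς l : ℤˣ) : ℤ) : ℂ) * (Complex.I * n) ^ n * (x : ℂ) ^ n * besselJ ς lam c x := by
  obtain ⟨ρ', d, hρ', hd, h0, hderiv⟩ := exists_contour_hasDerivAt hn ς hlam hρ hc n
  have hJ : ∀ y ∈ Set.Ioi (0 : ℝ), besselJ ς lam c y =
      1 / (2 * Real.pi * Complex.I) * ∫ t, besselDerivIntegrand ς lam d 0 y t :=
    fun y hy => by rw [besselJ, h0 y hy]
  have hiter : ∀ j ≤ n, iteratedDeriv j (besselJ ς lam c) x =
      1 / (2 * Real.pi * Complex.I) * ∫ t, besselDerivIntegrand ς lam d j x t := by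
    intro j hj
    have he : besselJ ς lam c =ᶠ[nhds x] fun y =>
        1 / (2 * Real.pi * Complex.I) * ∫ t, besselDerivIntegrand ς lam d 0 y t := by
      filter_upwards [isOpen_Ioi.mem_nhds hx] with y hy using hJ y hy
    rw [he.iteratedDeriv_eq]
    exact iteratedDeriv_eq_of_hasDerivAt (f := fun j y =>
      1 / (2 * Real.pi * Complex.I) * ∫ t, besselDerivIntegrand ς lam d j y t) isOpen_Ioi
      (fun j hj x hx => (hderiv j hj x hx).const_mul _) hj x hx
  have hshift : ∫ t, besselIntegrand ς lam (fun t => d t + 1) x t =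
      ∫ t, besselIntegrand ς lam c x t :=
    integral_besselIntegrand_eq ς hlam hd.add_one hc (by linarith) hρ hx
  have hint : ∀ j ∈ Finset.range (n + 1),
      MeasureTheory.Integrable (fun t => MvPolynomial.aeval lam (besselV n j) * (x : ℂ) ^ j *
        besselDerivIntegrand ς lam d j x t) := by
    intro j hj
    have : (j : ℝ) ≤ n := by exact_mod_cast Nat.lt_succ_iff.1 (Finset.mem_range.1 hj)
    exact (integrable_besselDerivIntegrand ς hlam hd (by linarith) hx).const_mul _
  have hsum : ∑ j ∈ Finset.range (n + 1), MvPolynomial.aeval lam (besselV n j) * (x : ℂ) ^ j *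
      ∫ t, besselDerivIntegrand ς lam d j x t =
      (((∏ l, ς l : ℤˣ) : ℤ) : ℂ) * (Complex.I * n) ^ n * (x : ℂ) ^ n *
        ∫ t, besselIntegrand ς lam c x t := by
    rw [← hshift, ← MeasureTheory.integral_const_mul]
    simp_rw [← MeasureTheory.integral_const_mul]
    rw [← MeasureTheory.integral_finsetSum _ hint]
    exact MeasureTheory.integral_congr_ae (Filter.Eventually.of_forall
      (sum_besselV_mul_besselDerivIntegrand ς hd hx))
  rw [besselJ, mul_left_comm, ← hsum, Finset.mul_sum]
  refine Finset.sum_congr rfl fun j hj => ?_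
  rw [hiter j (Nat.lt_succ_iff.1 (Finset.mem_range.1 hj))]
  ring

theorem theorem6 (n : ℕ) (hn : 1 ≤ n) (ς : Fin n → ℤˣ) (lam : Fin n → ℂ)
    (hlam : ∑ l, lam l = 0) (c : ℝ → ℝ) (hc : IsBarnesContour lam c) :
    (∀ x : ℝ, 0 < x → MeasureTheory.Integrable (besselIntegrand ς lam c x)) ∧
    ContDiffOn ℝ ∞ (besselJ ς lam c) (Set.Ioi 0) ∧
    (∀ x : ℝ, 0 < x →
      ∑ j ∈ Finset.Icc 1 n, MvPolynomial.aeval lam (besselV n j) * (x : ℂ) ^ j *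
          iteratedDeriv j (besselJ ς lam c) x +
        (MvPolynomial.aeval lam (besselV n 0) -
          (((∏ l, ς l : ℤˣ) : ℤ) : ℂ) * (Complex.I * n) ^ n * (x : ℂ) ^ n) *
          besselJ ς lam c x = 0) ∧
    (∀ j ≤ n, (besselV n j).IsSymmetric) ∧
    besselV n n = 1 ∧
    MvPolynomial.aeval lam (MvPolynomial.esymm (Fin n) ℤ 1) = 0 ∧
    besselA 0 0 = 1 ∧
    (∀ m : ℕ, 1 ≤ m → besselA 0 m = 0) ∧
    (∀ j m : ℕ, 1 ≤ j →
      (besselA j m : ℚ) = ∑ r ∈ Finset.Icc 1 j,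
        (-1 : ℚ) ^ (j - r) * (r : ℚ) ^ (m + j) / ((r.factorial : ℚ) * ((j - r).factorial : ℚ))) := by
  obtain ⟨ρ, hρ, hc⟩ := hc.exists_isContourOfAbscissa
  have hn0 : (0 : ℝ) < n := by exact_mod_cast hn
  have hρ : n * (ρ - 1 / 2) < -1 := by
    have h := mul_lt_mul_of_pos_left hρ hn0
    have h' : (n : ℝ) * (1 / n) = 1 := by field_simp
    linarith
  refine ⟨fun x hx => ?_, contDiffOn_besselJ hn ς hlam hρ hc, fun x hx => ?_,
    fun j _ => besselV_isSymmetric n j, besselV_self n, ?_, besselA_zero_right 0,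
    fun m hm => ?_, besselA_eq_sum⟩
  · rw [← besselDerivIntegrand_zero]
    exact integrable_besselDerivIntegrand ς hlam hc (by simpa using hρ) hx
  · have h := besselJ_differential_equation hn ς hlam hρ hc hx
    rw [Finset.range_eq_Ico, Finset.sum_eq_sum_Ico_succ_bot (by lia), zero_add,
      Finset.Ico_add_one_right_eq_Icc, iteratedDeriv_zero, pow_zero, mul_one] at h
    linear_combination h
  · rw [MvPolynomial.esymm_one, map_sum]
    simpa using hlam
  · obtain ⟨m, rfl⟩ := Nat.exists_eq_add_of_le' hm
    exact besselA_zero_left_succ m
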